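/- Fix an integer $k\ge 2$. A complete set of connected and disconnected $k$-sets on a finite set $V$ is a pair $(\mathcal S_k,\overline{\mathcal S}_k)$ of disjoint families of $k$-subsets of $V$ whose union is the family of all $k$-subsets of $V$ (the pair need not come from a graph). A simple graph $G$ on $V$ is consistent with $(\mathcal S_k,\overline{\mathcal S}_k)$ if $\mathcal S_k$ is exactly the family of $k$-subsets of $V$ that induce a connected subgraph of $G$, and $\overline{\mathcal S}_k$ is exactly the family of $k$-subsets of $V$ that induce a disconnected subgraph of $G$. Then all connected triangle-free graphs on $V$ that are consistent with a given complete set of connected and disconnected $k$-sets can be enumerated in time polynomial in $|V|$. That is, there are an algorithm and a polynomial $p$, both depending only on $k$, such that for every $n\ge 0$ and every complete set $(\mathcal S_k,\overline{\mathcal S}_k)$ of connected and disconnected $k$-sets on $V=\{0,\dots,n-1\}$, the algorithm, given $n$ and a listing of the members of $\mathcal S_k$ and of $\overline{\mathcal S}_k$ (in any order), halts after at most $p(n)$ steps, having output the adjacency matrices of exactly those connected triangle-free graphs on $V$ that are consistent with $(\mathcal S_k,\overline{\mathcal S}_k)$, each exactly once. (Algorithms are programs of a unit-cost random access machine on natural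 numbers whose only arithmetic operations are addition and truncated subtraction.) -/

import Mathlib

/-! ### Connected and disconnected `k`-sets -/

/-- The `k`-subsets of the vertex set that induce a connected subgraph of `G`. -/
def connectedKSets {V : Type*} (k : ℕ) (G : SimpleGraph V) : Set (Finset V) :=
  {S | S.card = k ∧ (G.induce (S : Set V)).Connected}

/-- The `k`-subsets of the vertex set that induce a disconnected subgraph of `G`. -/
def disconnectedKSets {V : Type*} (k : ℕ) (G : SimpleGraph V) : Set (Finset V) :=
  {S | S.card = k ∧ ¬ (G.induce (S : Set V)).Connected}

/-- `C`, `D` form a complete set of (connected and disconnected) `k`-sets on `V`: every `k`-subset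
of `V` lies in exactly one of `C` and `D`, and `C` and `D` have no other members. They need not
come from a graph. -/
structure IsCompleteKSets {V : Type*} (k : ℕ) (C D : Finset (Finset V)) : Prop where
  disjoint : Disjoint C D
  mem_iff : ∀ S : Finset V, S ∈ C ∨ S ∈ D ↔ S.card = k

/-- `G` is consistent with the connected `k`-sets `C` and the disconnected `k`-sets `D`. -/
def IsConsistent {V : Type*} (k : ℕ) (C D : Finset (Finset V)) (G : SimpleGraph V) : Prop :=
  connectedKSets k G = (C : Set (Finset V)) ∧ disconnectedKSets k G = (D : Set (Finset V))

/-! ### A random access machine with unit cost -/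

namespace RAM

/-- Programs of a random access machine with registers and a memory, both indexed by `ℕ` and
holding natural numbers, and with a write-only output. A program mentions finitely many registers;
the memory is addressed indirectly. The only arithmetic is addition and truncated subtraction. -/
inductive Prog : Type
  /-- do nothing -/
  | skip
  /-- `reg r := c` -/
  | const (r c : ℕ)
  /-- `reg r := reg a + reg b` -/
  | add (r a b : ℕ)
  /-- `reg r := reg a - reg b` (truncated) -/
  | sub (r a b : ℕ)
  /-- `reg r := mem (reg a)` -/
  | load (r a : ℕ)
  /-- `mem (reg a) := reg r` -/
  | store (a r : ℕ)
  /-- append `reg r` to the output -/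
  | emit (r : ℕ)
  /-- run `P`, then `Q` -/
  | seq (P Q : Prog)
  /-- if `reg r ≠ 0` then run `P`, else run `Q` -/
  | branch (r : ℕ) (P Q : Prog)
  /-- while `reg r ≠ 0`, run `P` -/
  | loop (r : ℕ) (P : Prog)

/-- A configuration of the machine. -/
@[ext]
structure Cfg : Type where
  /-- the registers -/
  reg : ℕ → ℕ
  /-- the memory -/
  mem : ℕ → ℕ
  /-- what has been output so far -/
  out : List ℕ

/-- The initial configuration: the input occupies the cells `0, 1, 2, …` of the memory, all other
cells and all registers hold `0`, and nothing has been output. -/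
def init (input : List ℕ) : Cfg where
  reg _ := 0
  mem i := input.getD i 0
  out := []

/-- Assignment to a register. -/
def Cfg.setReg (s : Cfg) (r v : ℕ) : Cfg := { s with reg := Function.update s.reg r v }

/-- Assignment to a memory cell. -/
def Cfg.setMem (s : Cfg) (i v : ℕ) : Cfg := { s with mem := Function.update s.mem i v }

/-- `Runs P s t s'`: started in `s`, the program `P` halts in `s'` after exactly `t` steps. Every
elementary instruction and every evaluation of the test of a branch or a loop is one step. -/
inductive Runs : Prog → Cfg → ℕ → Cfg → Prop
  | skip (s : Cfg) : Runs .skip s 1 s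
  | const (s : Cfg) (r c : ℕ) : Runs (.const r c) s 1 (s.setReg r c)
  | add (s : Cfg) (r a b : ℕ) : Runs (.add r a b) s 1 (s.setReg r (s.reg a + s.reg b))
  | sub (s : Cfg) (r a b : ℕ) : Runs (.sub r a b) s 1 (s.setReg r (s.reg a - s.reg b))
  | load (s : Cfg) (r a : ℕ) : Runs (.load r a) s 1 (s.setReg r (s.mem (s.reg a)))
  | store (s : Cfg) (a r : ℕ) : Runs (.store a r) s 1 (s.setMem (s.reg a) (s.reg r))
  | emit (s : Cfg) (r : ℕ) : Runs (.emit r) s 1 { s with out := s.out ++ [s.reg r] }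
  | seq {P Q : Prog} {s s₁ s₂ : Cfg} {t₁ t₂ : ℕ} (h₁ : Runs P s t₁ s₁) (h₂ : Runs Q s₁ t₂ s₂) :
      Runs (.seq P Q) s (t₁ + t₂) s₂
  | branch_true {P Q : Prog} {s s' : Cfg} {r t : ℕ} (hr : s.reg r ≠ 0) (h : Runs P s t s') :
      Runs (.branch r P Q) s (t + 1) s'
  | branch_false {P Q : Prog} {s s' : Cfg} {r t : ℕ} (hr : s.reg r = 0) (h : Runs Q s t s') :
      Runs (.branch r P Q) s (t + 1) s'
  | loop_done {P : Prog} {s : Cfg} {r : ℕ} (hr : s.reg r = 0) : Runs (.loop r P) s 1 s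
  | loop_step {P : Prog} {s s₁ s₂ : Cfg} {r t₁ t₂ : ℕ} (hr : s.reg r ≠ 0)
      (h₁ : Runs P s t₁ s₁) (h₂ : Runs (.loop r P) s₁ t₂ s₂) :
      Runs (.loop r P) s (t₁ + t₂ + 1) s₂

/-- The machine is deterministic: the running time and the final configuration are unique. -/
theorem Runs.det {P : Prog} {s s₁ : Cfg} {t₁ : ℕ} (h₁ : Runs P s t₁ s₁) :
    ∀ {t₂ : ℕ} {s₂ : Cfg}, Runs P s t₂ s₂ → t₁ = t₂ ∧ s₁ = s₂ := by
  induction h₁ with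
  | seq _ _ ih₁ ih₂ =>
    intro t s h
    cases h with
    | seq g₁ g₂ =>
      obtain ⟨rfl, rfl⟩ := ih₁ g₁
      obtain ⟨rfl, rfl⟩ := ih₂ g₂
      exact ⟨rfl, rfl⟩
  | branch_true hr _ ih =>
    intro t s h
    cases h with
    | branch_true _ g => exact ⟨by rw [(ih g).1], (ih g).2⟩
    | branch_false hr' _ => exact absurd hr' hr
  | branch_false hr _ ih =>
    intro t s h
    cases h with
    | branch_true hr' _ => exact absurd hr hr'
    | branch_false _ g => exact ⟨by rw [(ih g).1], (ih g).2⟩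
  | loop_done hr =>
    intro t s h
    cases h with
    | loop_done _ => exact ⟨rfl, rfl⟩
    | loop_step hr' _ _ => exact absurd hr hr'
  | loop_step hr _ _ ih₁ ih₂ =>
    intro t s h
    cases h with
    | loop_done hr' => exact absurd hr' hr
    | loop_step _ g₁ g₂ =>
      obtain ⟨rfl, rfl⟩ := ih₁ g₁
      obtain ⟨rfl, rfl⟩ := ih₂ g₂
      exact ⟨rfl, rfl⟩
  | _ =>
    intro t s h
    cases h
    exact ⟨rfl, rfl⟩

end RAM

/-! ### Input and output -/

/-- A list of sets of vertices, written down as its length followed by the elements of every set,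
each set in increasing order. -/
def encodeSets {n : ℕ} (L : List (Finset (Fin n))) : List ℕ :=
  L.length :: L.flatMap fun S => (S.sort (· ≤ ·)).map fun v => (v : ℕ)

/-- The input: the number of vertices, the list of the connected `k`-sets, and the list of the
disconnected `k`-sets. -/
def encodeInput {n : ℕ} (LC LD : List (Finset (Fin n))) : List ℕ :=
  n :: (encodeSets LC ++ encodeSets LD)

open Classical in
/-- A graph on `n` vertices, written down row by row as its `n × n` adjacency matrix. -/
noncomputable def encodeGraph {n : ℕ} (G : SimpleGraph (Fin n)) : List ℕ :=
  (List.finRange n).flatMap fun i => (List.finRange n).map fun j => if G.Adj i j then 1 else 0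

/-- `L` lists the graphs with property `p`, each exactly once. -/
def Enumerates {n : ℕ} (L : List (SimpleGraph (Fin n))) (p : SimpleGraph (Fin n) → Prop) : Prop :=
  L.Nodup ∧ ∀ G, G ∈ L ↔ p G

/-!
A connected triangle-free graph on more than `4 * k ^ 2 + 2` vertices is determined by its connected
`k`-sets, and adjacency is a first-order property of the two given families (`ruleGraph`,
`IsConsistent.eq_ruleGraph`). So there is a single candidate for large `n`. It is computed and
checked in polynomial time. For the finitely many small `n`, the machine checks every graph on `n`
vertices; these graphs are hard-wired into the program.

Two kinds of evidence for an edge `uv` are used. For `PathRule`, let `B` be a connected `k`-set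
none of whose vertices is `v` or a neighbour of `v`; a connected `k`-set inside `B ∪ {u, v}` that
contains `v` can only be held together by the edge `uv`. For `StarRule`, a set `I` of `2 * k`
vertices is such that the `k`-subsets of `I ∪ {u}` are connected exactly when they contain `u`;
then `u` is adjacent to all of `I`. Both rules are sound for every consistent graph
(`IsConsistent.adj_of_pathRule`, `IsConsistent.adj_of_starRule`). Conversely, let `uv` be an edge.
If `u` has degree at least `2 * k`, its neighbours are pairwise nonadjacent, because there are no
triangles, and the star rule applies. If both degrees are smaller, consider the components of the
neighbours of `u` outside the closed neighbourhood of `v`, and those of the neighbours of `v`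
outside the closed neighbourhood of `u`: together with `u` and `v` they form a set that is closed
under adjacency, hence everything. As there are fewer than `4 * k` of them, one has at least `k`
vertices, and the path rule applies (`IsConsistent.pathRule_of_degree`).

Programs are not written for the machine directly but in a language of bounded loops: expressions
(`RAM.Expr`) with sums over all numbers below a bound `b`, which serve as bounded quantifiers, and
statements (`RAM.Stmt`) with loops over all numbers below `b`. Every program of this language
terminates, and its running time is at most a polynomial in `b` that is read off from its syntax
(`RAM.Expr.runs_compile`, `RAM.Stmt.runs_compile`). The bound is `n + |C| + |D| + k`, which is at
most `n + n ^ k + k`. Since `k` is fixed, the rules, triangle-freeness and the consistency of a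
candidate are expressions; only the connectivity of the candidate needs the memory, in which the
vertices reachable from vertex `0` are marked (`RAM.markComponent`).
-/

/-! ### Connected induced subgraphs -/

namespace SimpleGraph

variable {V : Type*} {G : SimpleGraph V}

/-- A finite vertex set induces a connected subgraph iff it is nonempty and every nontrivial cut of
it is crossed by an edge. -/
theorem induce_connected_iff_cut {S : Finset V} :
    (G.induce (S : Set V)).Connected ↔
      S.Nonempty ∧ ∀ A ⊆ S, A.Nonempty → A ≠ S → ∃ a ∈ A, ∃ b ∈ S, b ∉ A ∧ G.Adj a b := by
  classical
  constructor
  · intro h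
    refine ⟨by obtain ⟨x⟩ := h.nonempty; exact ⟨x, x.2⟩, fun A hA ⟨x, hx⟩ hne => ?_⟩
    obtain ⟨y, hyS, hyA⟩ : ∃ y ∈ S, y ∉ A := by
      by_contra! hcon
      exact hne (hA.antisymm hcon)
    obtain ⟨p⟩ := h.preconnected ⟨x, hA hx⟩ ⟨y, hyS⟩
    obtain ⟨d, -, h1, h2⟩ := p.exists_boundary_dart {z | (z : V) ∈ A} hx hyA
    exact ⟨_, h1, _, d.snd.2, h2, d.adj⟩
  · rintro ⟨⟨x, hx⟩, h⟩
    rw [connected_iff_exists_forall_reachable]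
    refine ⟨⟨x, hx⟩, ?_⟩
    by_contra! ⟨w, hw⟩
    let A : Finset V := S.filter fun y => ∃ hy : y ∈ S,
      (G.induce (S : Set V)).Reachable ⟨x, hx⟩ ⟨y, hy⟩
    obtain ⟨a, ha, b, hb, hbA, hab⟩ := h A (Finset.filter_subset _ _)
      ⟨x, by simp only [A, Finset.mem_filter]; exact ⟨hx, hx, Reachable.refl _⟩⟩ (by
        intro hA
        have : (w : V) ∈ A := by rw [hA]; exact w.2
        simp only [A, Finset.mem_filter] at this
        exact hw this.2.2)
    simp only [A, Finset.mem_filter] at ha hbA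
    obtain ⟨ha, _, hr⟩ := ha
    refine hbA ⟨hb, hb, hr.trans ?_⟩
    exact Adj.reachable (by simpa using hab)

theorem induce_singleton_connected (v : V) :
    (G.induce (({v} : Finset V) : Set V)).Connected := by
  rw [induce_connected_iff_cut]
  refine ⟨by simp, fun A hA hne h => ?_⟩
  rcases Finset.subset_singleton_iff.1 hA with rfl | rfl
  · simp at hne
  · exact absurd rfl h

/-- In a connected induced subgraph with at least two vertices, every vertex has a neighbour. -/
theorem exists_adj_of_induce_connected {S : Finset V} (h : (G.induce (S : Set V)).Connected)
    (hS : 2 ≤ S.card) {v : V} (hv : v ∈ S) : ∃ w ∈ S, G.Adj v w := by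
  obtain ⟨a, ha, b, hb, -, hab⟩ := (induce_connected_iff_cut.1 h).2 {v} (by simpa) (by simp) (by
    rintro rfl
    simp at hS)
  rw [Finset.mem_singleton] at ha
  exact ⟨b, hb, ha ▸ hab⟩

variable [DecidableEq V]

theorem induce_insert_connected {S : Finset V} (h : (G.induce (S : Set V)).Connected) {a b : V}
    (ha : a ∈ S) (hab : G.Adj a b) :
    (G.induce ((insert b S : Finset V) : Set V)).Connected := by
  have := induce_union_connected h.preconnected (induce_pair_connected_of_adj hab).preconnected
    ⟨a, ha, by simp⟩
  have heq : ((insert b S : Finset V) : Set V) = (S : Set V) ∪ {a, b} := by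
    ext x
    have : x = a → x ∈ S := fun h => h ▸ ha
    simp only [Finset.coe_insert, Set.mem_insert_iff, Finset.mem_coe, Set.mem_union,
      Set.mem_singleton_iff]
    tauto
  rwa [heq]

/-- A connected set contains connected sets of every smaller size through any of its vertices. -/
theorem exists_connected_subset_card {S : Finset V} (h : (G.induce (S : Set V)).Connected) {u : V}
    (hu : u ∈ S) (m : ℕ) (hm : 1 ≤ m) (hmS : m ≤ S.card) :
    ∃ T ⊆ S, u ∈ T ∧ T.card = m ∧ (G.induce (T : Set V)).Connected := by
  induction m, hm using Nat.le_induction with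
  | base => exact ⟨{u}, by simpa, by simp, by simp, induce_singleton_connected u⟩
  | succ m hm ih =>
    obtain ⟨T, hTS, huT, hT, hc⟩ := ih (by lia)
    obtain ⟨a, ha, b, hb, hbT, hab⟩ := (induce_connected_iff_cut.1 h).2 T hTS ⟨u, huT⟩ (by
      rintro rfl
      lia)
    exact ⟨insert b T, Finset.insert_subset hb hTS, by simp [huT],
      by rw [Finset.card_insert_of_notMem hbT, hT], induce_insert_connected hc ha hab⟩

/-- A star is connected. -/
theorem induce_star_connected {u : V} {S : Finset V} (hu : u ∈ S)
    (h : ∀ x ∈ S, x ≠ u → G.Adj u x) : (G.induce (S : Set V)).Connected := by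
  rw [induce_connected_iff_cut]
  refine ⟨⟨u, hu⟩, fun A hA ⟨x, hx⟩ hne => ?_⟩
  obtain ⟨y, hyS, hyA⟩ : ∃ y ∈ S, y ∉ A := by
    by_contra! hcon
    exact hne (hA.antisymm hcon)
  by_cases huA : u ∈ A
  · exact ⟨u, huA, y, hyS, hyA, h y hyS (by rintro rfl; exact hyA huA)⟩
  · exact ⟨x, hx, u, hu, huA, (h x (hA hx) (by rintro rfl; exact huA hx)).symm⟩

/-- Inside a region `R`, every vertex `c ∈ R` has a connected set that is closed under taking
neighbours in `R`: its component. -/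
theorem exists_connected_closed_subset {R : Finset V} {c : V} (hc : c ∈ R) :
    ∃ K ⊆ R, c ∈ K ∧ (G.induce (K : Set V)).Connected ∧
      ∀ x ∈ K, ∀ y ∈ R, G.Adj x y → y ∈ K := by
  classical
  obtain ⟨K, hK, hmax⟩ := Finset.exists_max_image
    (R.powerset.filter fun K : Finset V => c ∈ K ∧ (G.induce (K : Set V)).Connected) Finset.card
    ⟨{c}, by simp only [Finset.mem_filter]; exact ⟨by simpa, by simp, induce_singleton_connected c⟩⟩
  simp only [Finset.mem_filter, Finset.mem_powerset] at hK hmax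
  refine ⟨K, hK.1, hK.2.1, hK.2.2, fun x hx y hy hxy => ?_⟩
  by_contra hyK
  have := hmax (insert y K) ⟨Finset.insert_subset hy hK.1, by simp [hK.2.1],
    induce_insert_connected hK.2.2 hx hxy⟩
  rw [Finset.card_insert_of_notMem hyK] at this
  lia

theorem CliqueFree.not_adj_of_adj_of_adj (h : G.CliqueFree 3) {a b c : V} (hab : G.Adj a b)
    (hac : G.Adj a c) : ¬ G.Adj b c :=
  fun hbc => h {a, b, c} (is3Clique_triple_iff.2 ⟨hab, hac, hbc⟩)

end SimpleGraph

/-! ### Recognising edges from connected and disconnected `k`-sets -/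

section Rules

open SimpleGraph

variable {V : Type*} {k : ℕ} {C D : Finset (Finset V)} {G : SimpleGraph V}

theorem IsConsistent.mem_left_iff (h : IsConsistent k C D G) {S : Finset V} :
    S ∈ C ↔ S.card = k ∧ (G.induce (S : Set V)).Connected := by
  have := Set.ext_iff.1 h.1 S
  simpa [connectedKSets] using this.symm

theorem IsConsistent.mem_right_iff (h : IsConsistent k C D G) {S : Finset V} :
    S ∈ D ↔ S.card = k ∧ ¬ (G.induce (S : Set V)).Connected := by
  have := Set.ext_iff.1 h.2 S
  simpa [disconnectedKSets] using this.symm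

variable [DecidableEq V]

/-- Evidence for an edge `uv` that uses a connected set `B` with `v` outside its closed
neighbourhood: some connected `k`-set contains `v` and is contained in `B ∪ {u, v}`. -/
def PathRule (C : Finset (Finset V)) (u v : V) : Prop :=
  ∃ B ∈ C, (∀ T ∈ C, T ⊆ insert v B → v ∉ T) ∧ ∃ T ∈ C, v ∈ T ∧ T ⊆ insert u (insert v B)

/-- Evidence for an edge `uv` that uses a set of `2 * k` vertices, given as a disjoint union of
two disconnected `k`-sets: the `k`-subsets of that set together with `u` are connected exactly
when they contain `u`. -/
def StarRule (C D : Finset (Finset V)) (u v : V) : Prop :=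
  ∃ T₁ ∈ D, ∃ T₂ ∈ D, Disjoint T₁ T₂ ∧ v ∈ T₁ ∧
    (∀ T ∈ C, T ⊆ insert u (T₁ ∪ T₂) → u ∈ T) ∧ ∀ T ∈ D, T ⊆ insert u (T₁ ∪ T₂) → u ∉ T

/-- The graph whose edges are the pairs with evidence of one of the two kinds. -/
def ruleGraph (C D : Finset (Finset V)) : SimpleGraph V :=
  SimpleGraph.fromRel fun u v => PathRule C u v ∨ StarRule C D u v

/-- The path rule produces edges only: `v` has no neighbour in `B`, since otherwise a connected
`(k - 1)`-subset of `B` through such a neighbour could be extended by `v`. -/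
theorem IsConsistent.adj_of_pathRule (hk : 2 ≤ k) (h : IsConsistent k C D G) {u v : V}
    (huv : PathRule C u v) : G.Adj u v := by
  obtain ⟨B, hB, hvB, T, hT, hvT, hTB⟩ := huv
  obtain ⟨hBk, hBc⟩ := h.mem_left_iff.1 hB
  obtain ⟨hTk, hTc⟩ := h.mem_left_iff.1 hT
  have hv : v ∉ B := hvB B hB (Finset.subset_insert _ _)
  obtain ⟨w, hwT, hvw⟩ := exists_adj_of_induce_connected hTc (by lia) hvT
  have hw := hTB hwT
  simp only [Finset.mem_insert] at hw
  rcases hw with rfl | rfl | hwB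
  · exact hvw.symm
  · exact absurd hvw (G.irrefl)
  · obtain ⟨S, hSB, hwS, hS, hSc⟩ := exists_connected_subset_card hBc hwB (k - 1) (by lia) (by lia)
    refine absurd (Finset.mem_insert_self v S)
      (hvB (insert v S) ?_ (Finset.insert_subset_insert v hSB))
    refine h.mem_left_iff.2 ⟨?_, induce_insert_connected hSc hwS hvw.symm⟩
    rw [Finset.card_insert_of_notMem fun h' => hv (hSB h')]
    lia

/-- The star rule produces edges only: with `v`, fewer than `k` vertices of the `2 * k` are `v`
or neighbours of `v`, so that `v` and `k - 2` of the other vertices form with `u` a connected set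
in which `v` has no neighbour but `u`. -/
theorem IsConsistent.adj_of_starRule (hk : 2 ≤ k) (hCD : IsCompleteKSets k C D)
    (h : IsConsistent k C D G) {u v : V} (huv : StarRule C D u v) : G.Adj u v := by
  classical
  obtain ⟨T₁, hT₁, T₂, hT₂, hdis, hv, hC, hD⟩ := huv
  set I := T₁ ∪ T₂ with hI
  have hIc : I.card = 2 * k := by
    rw [hI, Finset.card_union_of_disjoint hdis, (h.mem_right_iff.1 hT₁).1,
      (h.mem_right_iff.1 hT₂).1]
    lia
  have huI : u ∉ I := by
    rw [hI, Finset.mem_union, not_or]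
    exact ⟨hD _ hT₁ (Finset.subset_union_left.trans (Finset.subset_insert _ _)),
      hD _ hT₂ (Finset.subset_union_right.trans (Finset.subset_insert _ _))⟩
  have hvI : v ∈ I := Finset.mem_union_left _ hv
  let K := I.filter fun x => x = v ∨ G.Adj v x
  have hvK : v ∈ K := by simp [K, hvI]
  have hKI : K ⊆ I := Finset.filter_subset _ _
  have hK : K.card < k := by
    by_contra! hK
    have hKc : (G.induce (K : Set V)).Connected := induce_star_connected hvK (by
      intro x hx hxv
      simp only [K, Finset.mem_filter] at hx
      tauto)
    obtain ⟨T, hTK, -, hTk, hTc⟩ := exists_connected_subset_card hKc hvK k (by lia) hK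
    exact huI (hKI (hTK (hC T (h.mem_left_iff.2 ⟨hTk, hTc⟩)
      ((hTK.trans hKI).trans (Finset.subset_insert _ _)))))
  obtain ⟨R, hR, hRk⟩ := Finset.exists_subset_card_eq (s := I \ K) (n := k - 2) (by
    rw [Finset.card_sdiff_of_subset hKI]
    lia)
  have hRI : R ⊆ I := hR.trans Finset.sdiff_subset
  have hvR : v ∉ R := fun h' => (Finset.mem_sdiff.1 (hR h')).2 hvK
  have huR : u ∉ insert v R := by
    rw [Finset.mem_insert, not_or]
    exact ⟨fun h' => huI (h' ▸ hvI), fun h' => huI (hRI h')⟩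
  have hcard : (insert u (insert v R)).card = k := by
    rw [Finset.card_insert_of_notMem huR, Finset.card_insert_of_notMem hvR]
    lia
  have hsub : insert u (insert v R) ⊆ insert u I :=
    Finset.insert_subset_insert _ (Finset.insert_subset hvI hRI)
  have hmem : insert u (insert v R) ∈ C :=
    ((hCD.mem_iff _).2 hcard).resolve_right fun h' => hD _ h' hsub (Finset.mem_insert_self _ _)
  obtain ⟨w, hw, hvw⟩ := exists_adj_of_induce_connected (h.mem_left_iff.1 hmem).2 (by lia)
    (v := v) (by simp)
  simp only [Finset.mem_insert] at hw
  rcases hw with rfl | rfl | hw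
  · exact hvw.symm
  · exact absurd hvw G.irrefl
  · exact absurd (by simp [K, hRI hw, hvw]) (Finset.mem_sdiff.1 (hR hw)).2

/-- A connected `k`-set outside the closed neighbourhood of `v` that contains a neighbour of `u`
makes the path rule applicable to an edge `uv`. -/
theorem IsConsistent.pathRule_of_connected (hk : 2 ≤ k) (h : IsConsistent k C D G) {u v c : V}
    {B : Finset V} (huv : G.Adj u v) (hBk : B.card = k) (hBc : (G.induce (B : Set V)).Connected)
    (hc : c ∈ B) (huc : G.Adj u c) (hB : ∀ x ∈ B, x ≠ v ∧ ¬ G.Adj v x) : PathRule C u v := by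
  refine ⟨B, h.mem_left_iff.2 ⟨hBk, hBc⟩, fun T hT hTB hvT => ?_, ?_⟩
  · obtain ⟨hTk, hTc⟩ := h.mem_left_iff.1 hT
    obtain ⟨w, hwT, hvw⟩ := exists_adj_of_induce_connected hTc (by lia) hvT
    rcases Finset.mem_insert.1 (hTB hwT) with rfl | hw
    · exact G.irrefl hvw
    · exact (hB w hw).2 hvw
  · have hu : u ∉ B := fun hu => (hB u hu).2 huv.symm
    obtain ⟨S, hSB, huS, hS, hSc⟩ := exists_connected_subset_card
      (induce_insert_connected hBc hc huc.symm) (Finset.mem_insert_self u B) (k - 1) (by lia)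
      (by rw [Finset.card_insert_of_notMem hu]; lia)
    refine ⟨insert v S, h.mem_left_iff.2 ⟨?_, induce_insert_connected hSc huS huv⟩,
      Finset.mem_insert_self _ _, ?_⟩
    · rw [Finset.card_insert_of_notMem, hS]
      · lia
      · intro hv
        rcases Finset.mem_insert.1 (hSB hv) with rfl | hv
        · exact G.irrefl huv
        · exact (hB v hv).1 rfl
    · rw [Finset.insert_comm]
      exact Finset.insert_subset_insert _ hSB

/-- An edge at a vertex of degree at least `2 * k` is found by the star rule. -/
theorem IsConsistent.starRule_of_degree [Fintype V] [DecidableRel G.Adj] (hk : 2 ≤ k)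
    (hG : G.CliqueFree 3) (h : IsConsistent k C D G) {u v : V} (huv : G.Adj u v)
    (hu : 2 * k ≤ G.degree u) : StarRule C D u v := by
  have hind : ∀ T ⊆ G.neighborFinset u, T.card = k → T ∈ D := by
    refine fun T hT hTk => h.mem_right_iff.2 ⟨hTk, fun hTc => ?_⟩
    obtain ⟨x, hx⟩ : T.Nonempty := Finset.card_pos.1 (by lia)
    obtain ⟨y, hy, hxy⟩ := exists_adj_of_induce_connected hTc (by lia) hx
    have hx' := hT hx
    have hy' := hT hy
    rw [mem_neighborFinset] at hx' hy'
    exact hG.not_adj_of_adj_of_adj hx' hy' hxy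
  have huN : u ∉ G.neighborFinset u := by simp
  obtain ⟨T₁, hv₁, hT₁, hT₁k⟩ := Finset.exists_subsuperset_card_eq
    (s := {v}) (t := G.neighborFinset u) (n := k) (by simpa) (by simp; lia)
    (by rw [card_neighborFinset_eq_degree]; lia)
  obtain ⟨T₂, hT₂, hT₂k⟩ := Finset.exists_subset_card_eq (s := G.neighborFinset u \ T₁) (n := k)
    (by rw [Finset.card_sdiff_of_subset hT₁, card_neighborFinset_eq_degree]; lia)
  have hT₂N : T₂ ⊆ G.neighborFinset u := hT₂.trans Finset.sdiff_subset
  have hI : T₁ ∪ T₂ ⊆ G.neighborFinset u := Finset.union_subset hT₁ hT₂N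
  refine ⟨T₁, hind _ hT₁ hT₁k, T₂, hind _ hT₂N hT₂k,
    (Finset.disjoint_of_subset_left hT₂ Finset.sdiff_disjoint).symm,
    hv₁ (Finset.mem_singleton_self v), fun T hT hTI => ?_, fun T hT hTI huT => ?_⟩
  · by_contra huT
    obtain ⟨hTk, hTc⟩ := h.mem_left_iff.1 hT
    have := hind T (((Finset.subset_insert_iff_of_notMem huT).1 hTI).trans hI) hTk
    exact (h.mem_right_iff.1 this).2 hTc
  · refine (h.mem_right_iff.1 hT).2 (induce_star_connected huT fun x hx hxu => ?_)
    have := hI ((Finset.mem_insert.1 (hTI hx)).resolve_left hxu)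
    simpa using this

/-- In a large graph, an edge `uv` between two vertices of degree less than `2 * k` is found by the
path rule. Otherwise all components that a neighbour of `u` has outside the closed neighbourhood
of `v`, and vice versa, would have fewer than `k` vertices; but these components, with `u` and `v`,
exhaust the graph. -/
theorem IsConsistent.pathRule_of_degree [Fintype V] [DecidableRel G.Adj] (hk : 2 ≤ k)
    (hG : G.CliqueFree 3) (hconn : G.Connected) (h : IsConsistent k C D G)
    (hcard : 4 * k ^ 2 + 2 < Fintype.card V) {u v : V} (huv : G.Adj u v)
    (hu : G.degree u < 2 * k) (hv : G.degree v < 2 * k) : PathRule C u v ∨ PathRule C v u := by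
  by_contra! ⟨hruleu, hrulev⟩
  -- `K a b c` is the component of `c` outside the closed neighbourhood of `b`
  have hK : ∀ a b c : V, ∃ K : Finset V, G.Adj a b → ¬ PathRule C a b → G.Adj a c → c ≠ b →
      c ∈ K ∧ K.card < k ∧ ∀ x ∈ K, ∀ y, y ≠ b → ¬ G.Adj b y → G.Adj x y → y ∈ K := by
    intro a b c
    by_cases hab : G.Adj a b ∧ ¬ PathRule C a b ∧ G.Adj a c ∧ c ≠ b
    swap
    · exact ⟨∅, fun h1 h2 h3 h4 => absurd ⟨h1, h2, h3, h4⟩ hab⟩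
    obtain ⟨hab, hrule, hac, hcb⟩ := hab
    obtain ⟨K, hKR, hcK, hKc, hcl⟩ := exists_connected_closed_subset (G := G)
      (R := Finset.univ.filter fun x => x ≠ b ∧ ¬ G.Adj b x) (c := c)
      (by simpa using ⟨hcb, hG.not_adj_of_adj_of_adj hab hac⟩)
    refine ⟨K, fun _ _ _ _ => ⟨hcK, ?_,
      fun x hx y hyb hby hxy => hcl x hx y (by simp [hyb, hby]) hxy⟩⟩
    by_contra! hKk
    obtain ⟨B, hBK, hcB, hBk, hBc⟩ := exists_connected_subset_card hKc hcK k (by lia) hKk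
    refine hrule (h.pathRule_of_connected hk hab hBk hBc hcB hac fun x hx => ?_)
    simpa using hKR (hBK hx)
  choose K hK using hK
  let X : Finset V := {u, v} ∪ ((G.neighborFinset u \ {v}).biUnion (K u v) ∪
    (G.neighborFinset v \ {u}).biUnion (K v u))
  have hmem : ∀ x, x ∈ X ↔ x = u ∨ x = v ∨ (∃ c, G.Adj u c ∧ c ≠ v ∧ x ∈ K u v c) ∨
      ∃ c, G.Adj v c ∧ c ≠ u ∧ x ∈ K v u c := by
    intro x
    simp [X, and_assoc]
  have hclosed : ∀ x ∈ X, ∀ y, G.Adj x y → y ∈ X := by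
    have nbr_u : ∀ y, G.Adj u y → y ∈ X := by
      intro y hy
      rw [hmem]
      by_cases hyv : y = v
      · exact Or.inr (Or.inl hyv)
      · exact Or.inr (Or.inr (Or.inl ⟨y, hy, hyv, (hK u v y huv hruleu hy hyv).1⟩))
    have nbr_v : ∀ y, G.Adj v y → y ∈ X := by
      intro y hy
      rw [hmem]
      by_cases hyu : y = u
      · exact Or.inl hyu
      · exact Or.inr (Or.inr (Or.inr ⟨y, hy, hyu, (hK v u y huv.symm hrulev hy hyu).1⟩))
    intro x hx y hxy
    rcases (hmem x).1 hx with rfl | rfl | ⟨c, hc, hcv, hxc⟩ | ⟨c, hc, hcu, hxc⟩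
    · exact nbr_u y hxy
    · exact nbr_v y hxy
    · by_cases hy : G.Adj v y
      · exact nbr_v y hy
      by_cases hyv : y = v
      · exact (hmem y).2 (Or.inr (Or.inl hyv))
      · exact (hmem y).2 (Or.inr (Or.inr (Or.inl
          ⟨c, hc, hcv, (hK u v c huv hruleu hc hcv).2.2 x hxc y hyv hy hxy⟩)))
    · by_cases hy : G.Adj u y
      · exact nbr_u y hy
      by_cases hyu : y = u
      · exact (hmem y).2 (Or.inl hyu)
      · exact (hmem y).2 (Or.inr (Or.inr (Or.inr
          ⟨c, hc, hcu, (hK v u c huv.symm hrulev hc hcu).2.2 x hxc y hyu hy hxy⟩)))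
  have huniv : X = Finset.univ := by
    refine Finset.eq_univ_iff_forall.2 fun y => ?_
    by_contra hy
    obtain ⟨p⟩ := hconn.preconnected u y
    obtain ⟨d, -, h1, h2⟩ := p.exists_boundary_dart (X : Set V) ((hmem u).2 (Or.inl rfl)) hy
    exact h2 (hclosed _ h1 _ d.adj)
  have hXcard : X.card ≤ 2 + (2 * k * k + 2 * k * k) := by
    have key : ∀ a b : V, G.Adj a b → ¬ PathRule C a b → G.degree a < 2 * k →
        ((G.neighborFinset a \ {b}).biUnion (K a b)).card ≤ 2 * k * k := by
      intro a b hab hrule ha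
      refine (Finset.card_biUnion_le_card_mul _ _ k fun c hc => ?_).trans ?_
      · simp only [Finset.mem_sdiff, mem_neighborFinset, Finset.mem_singleton] at hc
        exact (hK a b c hab hrule hc.1 hc.2).2.1.le
      · refine Nat.mul_le_mul_right k ((Finset.card_le_card Finset.sdiff_subset).trans ?_)
        rw [card_neighborFinset_eq_degree]
        exact ha.le
    refine (Finset.card_union_le _ _).trans (add_le_add Finset.card_le_two ?_)
    exact (Finset.card_union_le _ _).trans
      (add_le_add (key u v huv hruleu hu) (key v u huv.symm hrulev hv))
  rw [huniv, Finset.card_univ] at hXcard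
  nlinarith

/-- A large connected triangle-free graph is determined by its connected `k`-sets. -/
theorem IsConsistent.eq_ruleGraph [Fintype V] (hk : 2 ≤ k) (hCD : IsCompleteKSets k C D)
    (hG : G.CliqueFree 3) (hconn : G.Connected) (h : IsConsistent k C D G)
    (hcard : 4 * k ^ 2 + 2 < Fintype.card V) : G = ruleGraph C D := by
  classical
  ext u v
  rw [ruleGraph, SimpleGraph.fromRel_adj]
  constructor
  · refine fun huv => ⟨huv.ne, ?_⟩
    by_cases hu : 2 * k ≤ G.degree u
    · exact Or.inl (Or.inr (h.starRule_of_degree hk hG huv hu))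
    by_cases hv : 2 * k ≤ G.degree v
    · exact Or.inr (Or.inr (h.starRule_of_degree hk hG huv.symm hv))
    rcases h.pathRule_of_degree hk hG hconn hcard huv (by lia) (by lia) with h' | h'
    · exact Or.inl (Or.inl h')
    · exact Or.inr (Or.inl h')
  · rintro ⟨-, (h' | h') | (h' | h')⟩
    · exact h.adj_of_pathRule hk h'
    · exact h.adj_of_starRule hk hCD h'
    · exact (h.adj_of_pathRule hk h').symm
    · exact (h.adj_of_starRule hk hCD h').symm

end Rules

/-! ### A language of bounded loops and its compiler -/

namespace RAM

@[simp] theorem Cfg.setReg_reg (s : Cfg) (r v j : ℕ) :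
    (s.setReg r v).reg j = if j = r then v else s.reg j := by
  simp [Cfg.setReg, Function.update_apply]

@[simp] theorem Cfg.setReg_mem (s : Cfg) (r v : ℕ) : (s.setReg r v).mem = s.mem := rfl

@[simp] theorem Cfg.setReg_out (s : Cfg) (r v : ℕ) : (s.setReg r v).out = s.out := rfl

@[simp] theorem Cfg.setMem_reg (s : Cfg) (r v : ℕ) : (s.setMem r v).reg = s.reg := rfl

@[simp] theorem Cfg.setMem_mem (s : Cfg) (r v : ℕ) :
    (s.setMem r v).mem = Function.update s.mem r v := rfl

/-- Expressions over variables and the memory, both indexed by `ℕ`, and one further number, the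
bound. The only iteration is summation over all numbers below the bound. -/
inductive Expr : Type
  /-- the bound -/
  | bnd
  /-- the value of a variable -/
  | var (i : ℕ)
  /-- a constant -/
  | const (c : ℕ)
  /-- addition -/
  | add (a b : Expr)
  /-- truncated subtraction -/
  | sub (a b : Expr)
  /-- the content of a memory cell -/
  | read (a : Expr)
  /-- the sum of the values of `e` when variable `i` runs through the numbers below the bound -/
  | sum (i : ℕ) (e : Expr)

namespace Expr

/-- The value of an expression, where `b` is the bound, `m` the memory and `ρ` gives the values of
the variables. -/
def eval (b : ℕ) (m : ℕ → ℕ) : Expr → (ℕ → ℕ) → ℕ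
  | bnd, _ => b
  | var i, ρ => ρ i
  | const c, _ => c
  | add x y, ρ => x.eval b m ρ + y.eval b m ρ
  | sub x y, ρ => x.eval b m ρ - y.eval b m ρ
  | read a, ρ => m (a.eval b m ρ)
  | sum i e, ρ => ∑ x ∈ Finset.range b, e.eval b m (Function.update ρ i x)

/-- All variables of an expression, free or bound, are below this number. -/
def numVars : Expr → ℕ
  | bnd => 0
  | var i => i + 1
  | const _ => 0
  | add x y => max x.numVars y.numVars
  | sub x y => max x.numVars y.numVars
  | read a => a.numVars
  | sum i e => max (i + 1) e.numVars

/-- A program that computes an expression in register `w`. Register `0` holds the bound, registers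
`1` and `2` hold the numbers `1` and `0`, register `i + 3` holds variable `i`, and the registers
from `w` on are free. The counter of a loop runs downwards. -/
def compile : ℕ → Expr → Prog
  | w, bnd => .add w 0 2
  | w, var i => .add w (i + 3) 2
  | w, const c => .const w c
  | w, add x y => .seq (x.compile w) (.seq (y.compile (w + 1)) (.add w w (w + 1)))
  | w, sub x y => .seq (x.compile w) (.seq (y.compile (w + 1)) (.sub w w (w + 1)))
  | w, read a => .seq (a.compile w) (.load w w)
  | w, sum i e =>
    .seq (.const w 0) (.seq (.add (w + 1) (i + 3) 2) (.seq (.add (w + 2) 0 2) (.seq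
      (.loop (w + 2) (.seq (.sub (i + 3) 0 (w + 2)) (.seq (e.compile (w + 3))
        (.seq (.add w w (w + 3)) (.sub (w + 2) (w + 2) 1)))))
      (.add (i + 3) (w + 1) 2))))

open Polynomial in
/-- A bound for the number of steps that the computation of an expression takes. -/
noncomputable def cost : Expr → Polynomial ℕ
  | bnd => 1
  | var _ => 1
  | const _ => 1
  | add x y => x.cost + y.cost + 1
  | sub x y => x.cost + y.cost + 1
  | read a => a.cost + 1
  | sum _ e => X * (e.cost + 4) + 5

theorem eval_congr (e : Expr) (b : ℕ) (m : ℕ → ℕ) {ρ ρ' : ℕ → ℕ}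
    (h : ∀ i < e.numVars, ρ i = ρ' i) : e.eval b m ρ = e.eval b m ρ' := by
  induction e generalizing ρ ρ' with
  | bnd => rfl
  | const c => rfl
  | var i => exact h i (Nat.lt_succ_self i)
  | add x y hx hy =>
    simp only [numVars, lt_sup_iff] at h
    simp only [eval]
    rw [hx fun i hi => h i (Or.inl hi), hy fun i hi => h i (Or.inr hi)]
  | sub x y hx hy =>
    simp only [numVars, lt_sup_iff] at h
    simp only [eval]
    rw [hx fun i hi => h i (Or.inl hi), hy fun i hi => h i (Or.inr hi)]
  | read a ha =>
    simp only [eval]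
    rw [ha h]
  | sum i e he =>
    simp only [numVars, lt_sup_iff] at h
    simp only [eval]
    refine Finset.sum_congr rfl fun x _ => he fun j hj => ?_
    simp only [Function.update_apply]
    split
    · rfl
    · exact h j (Or.inr hj)

/-- Correctness and running time of compiled expressions. -/
theorem runs_compile (e : Expr) : ∀ (w : ℕ) (s : Cfg), e.numVars + 3 ≤ w → s.reg 1 = 1 →
    s.reg 2 = 0 → ∃ (t : ℕ) (s' : Cfg), Runs (e.compile w) s t s' ∧ t ≤ e.cost.eval (s.reg 0) ∧
      s'.mem = s.mem ∧ s'.out = s.out ∧ (∀ i < w, s'.reg i = s.reg i) ∧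
      s'.reg w = e.eval (s.reg 0) s.mem fun i => s.reg (i + 3) := by
  induction e with
  | bnd =>
    intro w s hw h1 h2
    exact ⟨_, _, .add .., by simp [cost], rfl, rfl, fun i hi => by simp [hi.ne], by simp [eval, h2]⟩
  | var i =>
    intro w s hw h1 h2
    exact ⟨_, _, .add .., by simp [cost], rfl, rfl, fun i hi => by simp [hi.ne], by simp [eval, h2]⟩
  | const c =>
    intro w s hw h1 h2
    exact ⟨_, _, .const .., by simp [cost], rfl, rfl, fun i hi => by simp [hi.ne], by simp [eval]⟩
  | add x y hx hy | sub x y hx hy =>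
    intro w s hw h1 h2
    simp only [numVars] at hw
    obtain ⟨t₁, s₁, r₁, ht₁, hm₁, ho₁, hp₁, hv₁⟩ := hx w s (by lia) h1 h2
    obtain ⟨t₂, s₂, r₂, ht₂, hm₂, ho₂, hp₂, hv₂⟩ := hy (w + 1) s₁ (by lia)
      (by rw [hp₁ _ (by lia), h1]) (by rw [hp₁ _ (by lia), h2])
    have hy' : y.eval (s₁.reg 0) s₁.mem (fun i => s₁.reg (i + 3)) =
        y.eval (s.reg 0) s.mem fun i => s.reg (i + 3) := by
      rw [hm₁, hp₁ 0 (by lia)]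
      exact y.eval_congr _ _ fun i hi => hp₁ _ (by lia)
    rw [hp₁ 0 (by lia)] at ht₂
    first
    | refine ⟨_, _, .seq r₁ (.seq r₂ (.add ..)), ?_, ?_, ?_, ?_, ?_⟩
    | refine ⟨_, _, .seq r₁ (.seq r₂ (.sub ..)), ?_, ?_, ?_, ?_, ?_⟩
    · simp only [cost, Polynomial.eval_add, Polynomial.eval_one]
      lia
    · simp [hm₁, hm₂]
    · simp [ho₁, ho₂]
    · intro i hi
      simp [hi.ne, hp₂ i (by lia), hp₁ i hi]
    · simp [eval, hv₂, hy', hp₂ w (by lia), hv₁]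
  | read a ha =>
    intro w s hw h1 h2
    obtain ⟨t₁, s₁, r₁, ht₁, hm₁, ho₁, hp₁, hv₁⟩ := ha w s hw h1 h2
    refine ⟨_, _, .seq r₁ (.load ..), ?_, ?_, ?_, ?_, ?_⟩
    · simp only [cost, Polynomial.eval_add, Polynomial.eval_one]
      lia
    · simp [hm₁]
    · simp [ho₁]
    · intro i hi
      simp [hi.ne, hp₁ i hi]
    · simp [eval, hv₁, hm₁]
  | sum i e he =>
    intro w s hw h1 h2
    simp only [numVars] at hw
    -- the loop, started with counter `c`
    have loop : ∀ (c : ℕ) (s : Cfg), c ≤ s.reg 0 → s.reg (w + 2) = c → s.reg 1 = 1 →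
        s.reg 2 = 0 → ∃ (t : ℕ) (s' : Cfg),
          Runs (.loop (w + 2) (.seq (.sub (i + 3) 0 (w + 2)) (.seq (e.compile (w + 3))
            (.seq (.add w w (w + 3)) (.sub (w + 2) (w + 2) 1))))) s t s' ∧
          t ≤ c * (e.cost.eval (s.reg 0) + 4) + 1 ∧ s'.mem = s.mem ∧ s'.out = s.out ∧
          (∀ j < w, j ≠ i + 3 → s'.reg j = s.reg j) ∧ s'.reg (w + 1) = s.reg (w + 1) ∧
          s'.reg w = s.reg w + ∑ x ∈ Finset.Ico (s.reg 0 - c) (s.reg 0),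
            e.eval (s.reg 0) s.mem (Function.update (fun j => s.reg (j + 3)) i x) := by
      intro c
      induction c with
      | zero =>
        intro s _ hs h1 h2
        exact ⟨_, _, .loop_done hs, by simp, rfl, rfl, fun _ _ _ => rfl, rfl, by simp⟩
      | succ c ih =>
        intro s hc hs h1 h2
        obtain ⟨t₁, s₁, r₁, ht₁, hm₁, ho₁, hp₁, hv₁⟩ := he (w + 3)
          (s.setReg (i + 3) (s.reg 0 - s.reg (w + 2))) (by lia) (by simpa) (by simpa)
        set s₂ := (s₁.setReg w (s₁.reg w + s₁.reg (w + 3))) with hs₂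
        set s₃ := s₂.setReg (w + 2) (s₂.reg (w + 2) - s₂.reg 1) with hs₃
        have hp : ∀ j, j < w + 2 → j ≠ i + 3 → j ≠ w → s₃.reg j = s.reg j := by
          intro j hj hji hjw
          have e1 : j ≠ w + 2 := by lia
          simp only [hs₃, hs₂, Cfg.setReg_reg, if_neg e1, if_neg hjw]
          rw [hp₁ _ (by lia), Cfg.setReg_reg, if_neg hji]
        have h0 : s₃.reg 0 = s.reg 0 := hp 0 (by lia) (by lia) (by lia)
        have hcount : s₃.reg (w + 2) = c := by
          have e1 : w + 2 ≠ w := by lia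
          have e2 : (1 : ℕ) ≠ w := by lia
          have e3 : w + 2 ≠ i + 3 := by lia
          simp only [hs₃, hs₂, Cfg.setReg_reg, if_true, if_neg e1, if_neg e2]
          rw [hp₁ _ (by lia), hp₁ _ (by lia)]
          rw [Cfg.setReg_reg, if_neg e3, Cfg.setReg_reg, if_neg (by lia), hs, h1,
            Nat.add_sub_cancel]
        obtain ⟨t₄, s₄, r₄, ht₄, hm₄, ho₄, hp₄, hq₄, hv₄⟩ := ih s₃ (by lia) hcount
          (by rw [hp 1 (by lia) (by lia) (by lia), h1])
          (by rw [hp 2 (by lia) (by lia) (by lia), h2])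
        have hm₃ : s₃.mem = s.mem := by simp [hs₃, hs₂, hm₁]
        refine ⟨_, _, .loop_step (by lia) (.seq (.sub ..) (.seq r₁ (.seq (.add ..) (.sub ..)))) r₄,
          ?_, ?_, ?_, ?_, ?_, ?_⟩
        · rw [h0] at ht₄
          have e1 : (0 : ℕ) ≠ i + 3 := by lia
          rw [Cfg.setReg_reg, if_neg e1] at ht₁
          rw [add_mul]
          lia
        · rw [hm₄, hm₃]
        · simp [ho₄, hs₃, hs₂, ho₁]
        · intro j hj hji
          rw [hp₄ j hj hji, hp j (by lia) hji (by lia)]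
        · rw [hq₄, hp (w + 1) (by lia) (by lia) (by lia)]
        · have hw3 : s₃.reg w = s.reg w + e.eval (s.reg 0) s.mem
              (Function.update (fun j => s.reg (j + 3)) i (s.reg 0 - (c + 1))) := by
            have e1 : w ≠ w + 2 := by lia
            have e2 : w ≠ i + 3 := by lia
            simp only [hs₃, hs₂, Cfg.setReg_reg, if_true, if_neg e1]
            rw [hv₁, hp₁ w (by lia)]
            simp only [Cfg.setReg_reg, if_neg e2, Cfg.setReg_mem, hs]
            congr 1
            refine e.eval_congr _ _ fun j _ => ?_
            simp [Function.update_apply]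
          rw [hv₄, h0, hw3, hm₃,
            Finset.sum_eq_sum_Ico_succ_bot (show s.reg 0 - (c + 1) < s.reg 0 by lia),
            show s.reg 0 - (c + 1) + 1 = s.reg 0 - c by lia, ← add_assoc]
          congr 1
          refine Finset.sum_congr rfl fun x _ => e.eval_congr _ _ fun j hj => ?_
          simp only [Function.update_apply]
          split
          · rfl
          · exact hp _ (by lia) (by lia) (by lia)
    set s₁ := s.setReg w 0 with hs₁
    set s₂ := s₁.setReg (w + 1) (s₁.reg (i + 3) + s₁.reg 2) with hs₂
    set s₃ := s₂.setReg (w + 2) (s₂.reg 0 + s₂.reg 2) with hs₃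
    have hp₃ : ∀ j, j < w → s₃.reg j = s.reg j := by
      intro j hj
      simp [hs₃, hs₂, hs₁, show j ≠ w + 2 by lia, show j ≠ w + 1 by lia, hj.ne]
    have hc₃ : s₃.reg (w + 2) = s.reg 0 := by
      simp [hs₃, hs₂, hs₁, show (0 : ℕ) ≠ w by lia, show (2 : ℕ) ≠ w by lia,
        show (2 : ℕ) ≠ w + 1 by lia, h2]
    have hx₃ : s₃.reg (w + 1) = s.reg (i + 3) := by
      simp [hs₃, hs₂, hs₁, show i + 3 ≠ w by lia, show (2 : ℕ) ≠ w by lia, h2]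
    have hw₃ : s₃.reg w = 0 := by
      simp [hs₃, hs₂, hs₁]
    obtain ⟨t, s₄, r₄, ht₄, hm₄, ho₄, hp₄, hq₄, hv₄⟩ := loop (s.reg 0) s₃
      (hp₃ 0 (by lia)).ge hc₃ (by rw [hp₃ _ (by lia), h1]) (by rw [hp₃ _ (by lia), h2])
    have h04 : s₃.reg 0 = s.reg 0 := hp₃ 0 (by lia)
    refine ⟨_, _, .seq (.const ..) (.seq (.add ..) (.seq (.add ..) (.seq r₄ (.add ..)))),
      ?_, ?_, ?_, ?_, ?_⟩
    · rw [h04] at ht₄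
      simp only [cost, Polynomial.eval_add, Polynomial.eval_mul, Polynomial.eval_X,
        Polynomial.eval_ofNat]
      lia
    · simp [hm₄, hs₃, hs₂, hs₁]
    · simp [ho₄, hs₃, hs₂, hs₁]
    · intro j hj
      rw [Cfg.setReg_reg]
      split
      · next hji =>
        rw [hq₄, hx₃, hp₄ 2 (by lia) (by lia), hp₃ 2 (by lia), h2, hji, add_zero]
      · next hji => rw [hp₄ j hj hji, hp₃ j hj]
    · rw [Cfg.setReg_reg, if_neg (by lia), hv₄, hw₃, h04, zero_add, Nat.sub_self,
        ← Finset.range_eq_Ico]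
      simp only [eval]
      refine Finset.sum_congr rfl fun x _ => ?_
      rw [show s₃.mem = s.mem from rfl]
      refine e.eval_congr _ _ fun j hj => ?_
      simp only [Function.update_apply]
      split
      · rfl
      · exact hp₃ _ (by lia)

end Expr

/-- Statements: output, writing to the memory, conditionals, and loops in which a variable runs
through the numbers below the bound. -/
inductive Stmt : Type
  /-- do nothing -/
  | skip
  /-- write the value of `e` to the memory cell `a` -/
  | write (a e : Expr)
  /-- append the value of `e` to the output -/
  | emit (e : Expr)
  /-- one statement after the other -/
  | seq (P Q : Stmt)
  /-- `P` if the value of `e` is not `0`, else `Q` -/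
  | ite (e : Expr) (P Q : Stmt)
  /-- `P` for all values of variable `i` below the bound, in increasing order -/
  | loop (i : ℕ) (P : Stmt)

/-- A state of the execution of a statement. -/
structure State : Type where
  /-- the values of the variables -/
  var : ℕ → ℕ
  /-- the memory -/
  mem : ℕ → ℕ
  /-- the output so far -/
  out : List ℕ

/-- The value of an expression in a state. -/
def State.val (σ : State) (b : ℕ) (e : Expr) : ℕ := e.eval b σ.mem σ.var

/-- Assignment to a variable. -/
def State.set (σ : State) (i x : ℕ) : State := { σ with var := Function.update σ.var i x }

namespace Stmt

/-- Apply `f 0`, `f 1`, …, `f (c - 1)`, in this order. -/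
def iter (f : ℕ → State → State) : ℕ → State → State
  | 0, σ => σ
  | c + 1, σ => f c (iter f c σ)

/-- The effect of a statement on the state, where `b` is the bound. -/
def eval (b : ℕ) : Stmt → State → State
  | skip, σ => σ
  | write a e, σ => { σ with mem := Function.update σ.mem (σ.val b a) (σ.val b e) }
  | emit e, σ => { σ with out := σ.out ++ [σ.val b e] }
  | seq P Q, σ => Q.eval b (P.eval b σ)
  | ite e P Q, σ => if σ.val b e ≠ 0 then P.eval b σ else Q.eval b σ
  | loop i P, σ => iter (fun x τ => P.eval b (τ.set i x)) b σ

/-- All variables of a statement are below this number. -/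
def numVars : Stmt → ℕ
  | skip => 0
  | write a e => max a.numVars e.numVars
  | emit e => e.numVars
  | seq P Q => max P.numVars Q.numVars
  | ite e P Q => max e.numVars (max P.numVars Q.numVars)
  | loop i P => max (i + 1) P.numVars

/-- A program that executes a statement, with the registers used as in `Expr.compile`. -/
def compile : ℕ → Stmt → Prog
  | _, skip => .skip
  | w, write a e => .seq (a.compile w) (.seq (e.compile (w + 1)) (.store w (w + 1)))
  | w, emit e => .seq (e.compile w) (.emit w)
  | w, seq P Q => .seq (P.compile w) (Q.compile w)
  | w, ite e P Q => .seq (e.compile w) (.branch w (P.compile w) (Q.compile w))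
  | w, loop i P => .seq (.add w 0 2) (.loop w (.seq (.sub (i + 3) 0 w)
      (.seq (P.compile (w + 1)) (.sub w w 1))))

open Polynomial in
/-- A bound for the number of steps that the execution of a statement takes. -/
noncomputable def cost : Stmt → Polynomial ℕ
  | skip => 1
  | write a e => a.cost + e.cost + 1
  | emit e => e.cost + 1
  | seq P Q => P.cost + Q.cost
  | ite e P Q => e.cost + P.cost + Q.cost + 1
  | loop _ P => X * (P.cost + 3) + 2

/-- The configuration `s` represents the state `σ`, with registers below `w` in use and bound
`b`. -/
structure Represents (b w : ℕ) (σ : State) (s : Cfg) : Prop where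
  bound : s.reg 0 = b
  one : s.reg 1 = 1
  zero : s.reg 2 = 0
  var : ∀ i, i + 3 < w → s.reg (i + 3) = σ.var i
  mem : s.mem = σ.mem
  out : s.out = σ.out

theorem Represents.runs_expr {b v w : ℕ} {σ : State} {s : Cfg} (h : Represents b v σ s) {e : Expr}
    (he : e.numVars + 3 ≤ v) (hvw : v ≤ w) :
    ∃ (t : ℕ) (s' : Cfg), Runs (e.compile w) s t s' ∧ t ≤ e.cost.eval b ∧ Represents b v σ s' ∧
      (∀ i < w, s'.reg i = s.reg i) ∧ s'.reg w = σ.val b e := by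
  obtain ⟨t, s', r, ht, hm, ho, hp, hv⟩ := e.runs_compile w s (by lia) h.one h.zero
  refine ⟨t, s', r, h.bound ▸ ht, ⟨?_, ?_, ?_, ?_, ?_, ?_⟩, hp, ?_⟩
  · rw [hp 0 (by lia), h.bound]
  · rw [hp 1 (by lia), h.one]
  · rw [hp 2 (by lia), h.zero]
  · intro i hi
    rw [hp _ (by lia), h.var i hi]
  · rw [hm, h.mem]
  · rw [ho, h.out]
  · rw [hv, State.val, h.bound, h.mem]
    exact e.eval_congr _ _ fun i hi => h.var i (by lia)

theorem Represents.setReg {b v : ℕ} {σ : State} {s : Cfg} (h : Represents b v σ s) {r x : ℕ}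
    (hr : v ≤ r) (hv : 3 ≤ v) : Represents b v σ (s.setReg r x) where
  bound := by simp [show 0 ≠ r by lia, h.bound]
  one := by simp [show 1 ≠ r by lia, h.one]
  zero := by simp [show 2 ≠ r by lia, h.zero]
  var i hi := by simp [show i + 3 ≠ r by lia, h.var i hi]
  mem := h.mem
  out := h.out

theorem Represents.set {b v : ℕ} {σ : State} {s : Cfg} (h : Represents b v σ s) (i x : ℕ) :
    Represents b v (σ.set i x) (s.setReg (i + 3) x) where
  bound := by simp [h.bound]
  one := by simp [h.one]
  zero := by simp [h.zero]
  var j hj := by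
    simp only [Cfg.setReg_reg, State.set, Function.update_apply, add_left_inj]
    split
    · rfl
    · exact h.var j hj
  mem := h.mem
  out := h.out

/-- Correctness and running time of compiled statements. -/
theorem runs_compile (b v : ℕ) (P : Stmt) : ∀ (w : ℕ) (σ : State) (s : Cfg), P.numVars + 3 ≤ v →
    v ≤ w → Represents b v σ s → ∃ (t : ℕ) (s' : Cfg), Runs (P.compile w) s t s' ∧
      t ≤ P.cost.eval b ∧ Represents b v (P.eval b σ) s' ∧
      ∀ r, v ≤ r → r < w → s'.reg r = s.reg r := by
  induction P with
  | skip =>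
    intro w σ s _ _ h
    exact ⟨_, _, .skip s, by simp [cost], h, fun _ _ _ => rfl⟩
  | write a e =>
    intro w σ s hv hvw h
    simp only [numVars] at hv
    obtain ⟨t₁, s₁, r₁, ht₁, h₁, hp₁, hv₁⟩ := h.runs_expr (e := a) (by lia) hvw
    obtain ⟨t₂, s₂, r₂, ht₂, h₂, hp₂, hv₂⟩ :=
      h₁.runs_expr (e := e) (by lia) (hvw.trans (Nat.le_succ w))
    refine ⟨_, _, .seq r₁ (.seq r₂ (.store ..)), ?_,
      ⟨h₂.bound, h₂.one, h₂.zero, h₂.var, ?_, h₂.out⟩,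
      fun r _ hr => ?_⟩
    · simp only [cost, Polynomial.eval_add, Polynomial.eval_one]
      lia
    · rw [Cfg.setMem_mem, h₂.mem, hv₂, hp₂ w (by lia), hv₁]
      rfl
    · rw [Cfg.setMem_reg, hp₂ r (by lia), hp₁ r hr]
  | emit e =>
    intro w σ s hv hvw h
    obtain ⟨t₁, s₁, r₁, ht₁, h₁, hp₁, hv₁⟩ := h.runs_expr (e := e) hv hvw
    refine ⟨_, _, .seq r₁ (.emit ..), ?_, ⟨h₁.bound, h₁.one, h₁.zero, h₁.var, h₁.mem, ?_⟩,
      fun r _ hr => hp₁ r hr⟩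
    · simp only [cost, Polynomial.eval_add, Polynomial.eval_one]
      lia
    · simp [eval, h₁.out, hv₁]
  | seq P Q hP hQ =>
    intro w σ s hv hvw h
    simp only [numVars] at hv
    obtain ⟨t₁, s₁, r₁, ht₁, h₁, hp₁⟩ := hP w σ s (by lia) hvw h
    obtain ⟨t₂, s₂, r₂, ht₂, h₂, hp₂⟩ := hQ w _ s₁ (by lia) hvw h₁
    refine ⟨_, _, .seq r₁ r₂, ?_, h₂, fun r h1 h2 => by rw [hp₂ r h1 h2, hp₁ r h1 h2]⟩
    simp only [cost, Polynomial.eval_add]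
    lia
  | ite e P Q hP hQ =>
    intro w σ s hv hvw h
    simp only [numVars] at hv
    obtain ⟨t₁, s₁, r₁, ht₁, h₁, hp₁, hv₁⟩ := h.runs_expr (e := e) (by lia) hvw
    simp only [cost, Polynomial.eval_add, Polynomial.eval_one, eval]
    by_cases he : σ.val b e = 0
    · obtain ⟨t₂, s₂, r₂, ht₂, h₂, hp₂⟩ := hQ w σ s₁ (by lia) hvw h₁
      refine ⟨_, _, .seq r₁ (.branch_false (hv₁.trans he) r₂), by lia, by simpa [he] using h₂,
        fun r h1 h2 => by rw [hp₂ r h1 h2, hp₁ r h2]⟩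
    · obtain ⟨t₂, s₂, r₂, ht₂, h₂, hp₂⟩ := hP w σ s₁ (by lia) hvw h₁
      refine ⟨_, _, .seq r₁ (.branch_true (by rwa [hv₁]) r₂), by lia, by simpa [he] using h₂,
        fun r h1 h2 => by rw [hp₂ r h1 h2, hp₁ r h2]⟩
  | loop i P hP =>
    intro w σ s hv hvw h
    simp only [numVars] at hv
    -- the loop, started with counter `c`, performs the last `c` of the `b` iterations
    have loop : ∀ (c : ℕ) (s : Cfg), c ≤ b → s.reg w = c →
        Represents b v (iter (fun x τ => P.eval b (τ.set i x)) (b - c) σ) s →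
        ∃ (t : ℕ) (s' : Cfg), Runs (.loop w (.seq (.sub (i + 3) 0 w)
            (.seq (P.compile (w + 1)) (.sub w w 1)))) s t s' ∧
          t ≤ c * (P.cost.eval b + 3) + 1 ∧
          Represents b v (iter (fun x τ => P.eval b (τ.set i x)) b σ) s' ∧
          ∀ r, v ≤ r → r < w → s'.reg r = s.reg r := by
      intro c
      induction c with
      | zero =>
        intro s _ hs h
        exact ⟨_, _, .loop_done hs, by simp, h, fun _ _ _ => rfl⟩
      | succ c ih =>
        intro s hc hs h
        obtain ⟨t₁, s₁, r₁, ht₁, h₁, hp₁⟩ := hP (w + 1) _ _ (by lia) (by lia)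
          (h.set i (s.reg 0 - s.reg w))
        rw [h.bound, hs] at h₁
        have h₂ := h₁.setReg (x := s₁.reg w - s₁.reg 1) hvw (by lia)
        obtain ⟨t₃, s₃, r₃, ht₃, h₃, hp₃⟩ 
          := ih (s₁.setReg w (s₁.reg w - s₁.reg 1)) (by lia) (by
          rw [Cfg.setReg_reg, if_pos rfl, h₁.one, hp₁ w hvw (by lia), Cfg.setReg_reg,
            if_neg (by lia), hs]
          rfl) (by
            rw [show b - c = b - (c + 1) + 1 by lia]
            exact h₂)
        refine ⟨_, _, .loop_step (by lia) (.seq (.sub ..) (.seq r₁ (.sub ..))) r₃, ?_, h₃, ?_⟩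
        · rw [add_mul]
          lia
        · intro r h1 h2
          rw [hp₃ r h1 h2, Cfg.setReg_reg, if_neg (by lia), hp₁ r h1 (by lia), Cfg.setReg_reg,
            if_neg (by lia)]
    obtain ⟨t, s', r, ht, h', hp⟩ := loop b (s.setReg w (s.reg 0 + s.reg 2)) le_rfl
      (by simp [h.bound, h.zero]) (by
        rw [Nat.sub_self]
        exact h.setReg hvw (by lia))
    refine ⟨_, _, .seq (.add ..) r, ?_, h', fun q h1 h2 => ?_⟩
    · simp only [cost, Polynomial.eval_add, Polynomial.eval_mul, Polynomial.eval_X,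
        Polynomial.eval_ofNat]
      lia
    · rw [hp q h1 h2, Cfg.setReg_reg, if_neg (by lia)]

end Stmt

end RAM

/-! ### Logical connectives as expressions -/

namespace RAM

namespace Expr

/-- An expression, read as a condition, holds if its value is not `0`. -/
def Holds (b : ℕ) (m ρ : ℕ → ℕ) (e : Expr) : Prop := e.eval b m ρ ≠ 0

/-- Negation. -/
def not (e : Expr) : Expr := .sub (.const 1) e

/-- Disjunction. -/
def or (x y : Expr) : Expr := .add x y

/-- Conjunction. -/
def and (x y : Expr) : Expr := not (or (not x) (not y))

/-- Implication. -/
def imp (x y : Expr) : Expr := or (not x) y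

/-- Equality. -/
def eq (x y : Expr) : Expr := not (.add (.sub x y) (.sub y x))

/-- The strict order. -/
def lt (x y : Expr) : Expr := .sub y x

/-- Existential quantification over the numbers below the bound. -/
def ex (i : ℕ) (e : Expr) : Expr := .sum i e

/-- Universal quantification over the numbers below the bound. -/
def all (i : ℕ) (e : Expr) : Expr := not (.sum i (not e))

/-- A disjunction over a fixed finite type. -/
noncomputable def anyOf {ι : Type} [Fintype ι] (f : ι → Expr) : Expr :=
  (Finset.univ.toList.map f).foldr or (.const 0)

/-- A conjunction over a fixed finite type. -/
noncomputable def allOf {ι : Type} [Fintype ι] (f : ι → Expr) : Expr :=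
  not (anyOf fun i => not (f i))

/-- Multiplication by a constant. -/
def mulConst : ℕ → Expr → Expr
  | 0, _ => .const 0
  | k + 1, e => .add (mulConst k e) e

section

variable {b : ℕ} {m ρ : ℕ → ℕ} {x y e : Expr}

theorem eval_not : (not e).eval b m ρ = 1 - e.eval b m ρ := rfl

theorem holds_const {c : ℕ} : (const c).Holds b m ρ ↔ c ≠ 0 := Iff.rfl

theorem holds_not : (not e).Holds b m ρ ↔ ¬ e.Holds b m ρ := by
  simp only [Holds, not, eval]
  lia

theorem holds_or : (or x y).Holds b m ρ ↔ x.Holds b m ρ ∨ y.Holds b m ρ := by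
  simp only [Holds, or, eval]
  lia

theorem holds_and : (and x y).Holds b m ρ ↔ x.Holds b m ρ ∧ y.Holds b m ρ := by
  simp only [and, holds_not, holds_or]
  tauto

theorem holds_imp : (imp x y).Holds b m ρ ↔ (x.Holds b m ρ → y.Holds b m ρ) := by
  simp only [imp, holds_not, holds_or]
  tauto

theorem holds_eq : (eq x y).Holds b m ρ ↔ x.eval b m ρ = y.eval b m ρ := by
  simp only [Holds, eq, not, eval]
  lia

theorem holds_lt : (lt x y).Holds b m ρ ↔ x.eval b m ρ < y.eval b m ρ := by
  simp only [Holds, lt, eval]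
  lia

theorem holds_ex {i : ℕ} :
    (ex i e).Holds b m ρ ↔ ∃ x < b, e.Holds b m (Function.update ρ i x) := by
  simp [Holds, ex, eval]

theorem holds_all {i : ℕ} :
    (all i e).Holds b m ρ ↔ ∀ x < b, e.Holds b m (Function.update ρ i x) := by
  rw [all, holds_not]
  have : (sum i (not e)).Holds b m ρ ↔ _ := holds_ex (e := not e) (i := i)
  rw [this]
  simp [holds_not]

theorem holds_anyOf {ι : Type} [Fintype ι] {f : ι → Expr} :
    (anyOf f).Holds b m ρ ↔ ∃ i, (f i).Holds b m ρ := by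
  have : ∀ l : List ι, ((l.map f).foldr or (const 0)).Holds b m ρ ↔ ∃ i ∈ l, (f i).Holds b m ρ := by
    intro l
    induction l with
    | nil => simp [holds_const]
    | cons i l ih => simp [holds_or, ih]
  rw [anyOf, this]
  simp

theorem holds_allOf {ι : Type} [Fintype ι] {f : ι → Expr} :
    (allOf f).Holds b m ρ ↔ ∀ i, (f i).Holds b m ρ := by
  simp [allOf, holds_not, holds_anyOf]

theorem eval_mulConst (k : ℕ) : (mulConst k e).eval b m ρ = k * e.eval b m ρ := by
  induction k with
  | zero => simp [mulConst, eval]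
  | succ k ih => simp [mulConst, eval, ih, add_mul]

end

end Expr

/-! ### Lists of sets in the memory -/

/-- The cells `p, …, p + k - 1` of the memory hold the elements of `T`, each once. -/
def IsBlock {n : ℕ} (k : ℕ) (m : ℕ → ℕ) (p : ℕ) (T : Finset (Fin n)) : Prop :=
  ∃ f : Fin k → Fin n, Finset.univ.image f = T ∧ ∀ a : Fin k, m (p + a) = f a

/-- Expressions for the address at which a list of sets starts, and for its length. -/
structure ListExpr : Type where
  /-- the address of the first set -/
  start : Expr
  /-- the length -/
  length : Expr

/-- The memory `m` holds the list `L` of `k`-sets where the expressions `l` say. -/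
structure ListExpr.Represents {n : ℕ} (l : ListExpr) (k b : ℕ) (m : ℕ → ℕ)
    (L : List (Finset (Fin n))) : Prop where
  length_eq : ∀ ρ, l.length.eval b m ρ = L.length
  length_le : L.length ≤ b
  isBlock : ∀ (j : ℕ) (hj : j < L.length),
    ∃ p, (∀ ρ, l.start.eval b m ρ + k * j = p) ∧ IsBlock k m p L[j]

namespace ListExpr

open _root_.RAM.Expr

/-- Element number `a` of the set number `j`. -/
def elem (l : ListExpr) (k : ℕ) (j : Expr) (a : ℕ) : Expr :=
  .read (.add (.add l.start (mulConst k j)) (.const a))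

/-- `x` is an element of set number `j`. -/
noncomputable def memE (l : ListExpr) (k : ℕ) (j x : Expr) : Expr :=
  anyOf fun a : Fin k => eq (l.elem k j a) x

/-- All elements of set number `j` satisfy `φ`. -/
noncomputable def ballE (l : ListExpr) (k : ℕ) (j : Expr) (φ : Expr → Expr) : Expr :=
  allOf fun a : Fin k => φ (l.elem k j a)

/-- `e` holds for the number of some set of the list as value of variable `i`. -/
def exE (l : ListExpr) (i : ℕ) (e : Expr) : Expr := ex i (and (lt (.var i) l.length) e)

/-- `e` holds for the numbers of all sets of the list as value of variable `i`. -/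
def allE (l : ListExpr) (i : ℕ) (e : Expr) : Expr := all i (imp (lt (.var i) l.length) e)

variable {n k b : ℕ} {l : ListExpr} {m ρ : ℕ → ℕ} {L : List (Finset (Fin n))}

theorem Represents.exists_elem (h : l.Represents k b m L) {j : ℕ} (hj : j < L.length) :
    ∃ f : Fin k → Fin n, Finset.univ.image f = L[j] ∧
      ∀ (ρ : ℕ → ℕ) (e : Expr), e.eval b m ρ = j →
        ∀ a : Fin k, (l.elem k e a).eval b m ρ = f a := by
  obtain ⟨p, hp, f, hf, hm⟩ := h.isBlock j hj
  refine ⟨f, hf, fun ρ e he a => ?_⟩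
  rw [← hm a, ← hp ρ]
  simp [elem, eval, eval_mulConst, he]

theorem Represents.holds_memE (h : l.Represents k b m L) {j : ℕ} (hj : j < L.length) {e x : Expr}
    (he : e.eval b m ρ = j) {v : Fin n} (hx : x.eval b m ρ = v) :
    (l.memE k e x).Holds b m ρ ↔ v ∈ L[j] := by
  obtain ⟨f, hf, hm⟩ := h.exists_elem hj
  replace hm := hm ρ e he
  simp only [memE, holds_anyOf, holds_eq, hm, hx, ← hf, Finset.mem_image, Finset.mem_univ,
    true_and, Fin.ext_iff]

theorem Represents.holds_ballE (h : l.Represents k b m L) {j : ℕ} (hj : j < L.length) {e : Expr}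
    (he : e.eval b m ρ = j) {φ : Expr → Expr} {Q : Fin n → Prop}
    (hφ : ∀ (x : Expr) (v : Fin n), x.eval b m ρ = v → ((φ x).Holds b m ρ ↔ Q v)) :
    (l.ballE k e φ).Holds b m ρ ↔ ∀ v ∈ L[j], Q v := by
  obtain ⟨f, hf, hm⟩ := h.exists_elem hj
  replace hm := hm ρ e he
  simp only [ballE, holds_allOf, ← hf, Finset.mem_image, Finset.mem_univ, true_and,
    forall_exists_index, forall_apply_eq_imp_iff]
  exact forall_congr' fun a => hφ _ _ (hm a)

theorem Represents.holds_exE (h : l.Represents k b m L) {i : ℕ} {e : Expr}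
    {Q : Finset (Fin n) → Prop}
    (he : ∀ (j : ℕ) (hj : j < L.length), e.Holds b m (Function.update ρ i j) ↔ Q L[j]) :
    (l.exE i e).Holds b m ρ ↔ ∃ T ∈ L, Q T := by
  simp only [exE, holds_ex, holds_and, holds_lt, h.length_eq, eval, Function.update_self,
    List.exists_mem_iff_getElem]
  constructor
  · rintro ⟨j, -, hj, hQ⟩
    exact ⟨j, hj, (he j hj).1 hQ⟩
  · rintro ⟨j, hj, hQ⟩
    exact ⟨j, hj.trans_le h.length_le, hj, (he j hj).2 hQ⟩

theorem Represents.holds_allE (h : l.Represents k b m L) {i : ℕ} {e : Expr}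
    {Q : Finset (Fin n) → Prop}
    (he : ∀ (j : ℕ) (hj : j < L.length), e.Holds b m (Function.update ρ i j) ↔ Q L[j]) :
    (l.allE i e).Holds b m ρ ↔ ∀ T ∈ L, Q T := by
  simp only [allE, holds_all, holds_imp, holds_lt, h.length_eq, eval, Function.update_self,
    List.forall_mem_iff_getElem]
  exact ⟨fun H j hj => (he j hj).1 (H j (hj.trans_le h.length_le) hj),
    fun H j _ hj => (he j hj).2 (H j hj)⟩

end ListExpr

end RAM

/-! ### The layout of the input -/

theorem List.length_flatMap_of_length_eq {α β : Type*} {k : ℕ} {f : α → List β} {L : List α}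
    (h : ∀ x ∈ L, (f x).length = k) : (L.flatMap f).length = k * L.length := by
  induction L with
  | nil => simp
  | cons x L ih =>
    simp only [List.flatMap_cons, List.length_append, List.length_cons, h x (by simp),
      ih fun y hy => h y (by simp [hy])]
    ring

theorem List.getElem?_flatMap_of_length_eq {α β : Type*} {k : ℕ} {f : α → List β} {L : List α}
    (h : ∀ x ∈ L, (f x).length = k) {j a : ℕ} (hj : j < L.length) (ha : a < k) :
    (L.flatMap f)[k * j + a]? = (f L[j])[a]? := by
  induction L generalizing j with
  | nil => simp at hj
  | cons x L ih =>
    have hx := h x (by simp)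
    rw [List.flatMap_cons]
    cases j with
    | zero =>
      rw [List.getElem?_append_left (by lia)]
      simp
    | succ j =>
      rw [List.getElem?_append_right (by rw [hx]; nlinarith), hx,
        show k * (j + 1) + a - k = k * j + a by rw [mul_add]; lia,
        ih (fun y hy => h y (by simp [hy])) (by simpa using hj)]
      simp

/-- The elements of a set of vertices in increasing order. -/
def setCode {n : ℕ} (S : Finset (Fin n)) : List ℕ := List.map Fin.val (S.sort (· ≤ ·))

theorem length_setCode {n : ℕ} (S : Finset (Fin n)) : (setCode S).length = S.card := by
  simp [setCode]

theorem encodeSets_eq {n : ℕ} (L : List (Finset (Fin n))) :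
    encodeSets L = L.length :: L.flatMap setCode := by
  simp only [encodeSets, List.map_id', List.pure_def, List.bind_eq_flatMap]
  congr 1
  exact List.flatMap_congr fun S _ => List.map_eq_flatMap.symm

namespace RAM

/-- The length of the input. -/
def inputLength {n : ℕ} (k : ℕ) (LC LD : List (Finset (Fin n))) : ℕ :=
  3 + k * LC.length + k * LD.length

/-- The memory still holds the input, which consists of lists `LC` and `LD` of `k`-sets, and the
bound is large enough for loops over the vertices and over the lists. -/
structure IsInput {n : ℕ} (k b : ℕ) (LC LD : List (Finset (Fin n))) (m : ℕ → ℕ) : Prop where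
  le_bound : n ≤ b
  length_left_le : LC.length ≤ b
  length_right_le : LD.length ≤ b
  card_left : ∀ T ∈ LC, T.card = k
  card_right : ∀ T ∈ LD, T.card = k
  mem_eq : ∀ i < inputLength k LC LD, m i = (encodeInput LC LD).getD i 0

open _root_.RAM.Expr

/-- The number of vertices. -/
def numE : Expr := .read (.const 0)

/-- The list of the connected sets. -/
def listC : ListExpr := ⟨.const 2, .read (.const 1)⟩

/-- The list of the disconnected sets. -/
def listD (k : ℕ) : ListExpr :=
  ⟨.add (.const 3) (mulConst k listC.length), .read (.add (.const 2) (mulConst k listC.length))⟩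

/-- The length of the input, which is the address of the first free memory cell. -/
def freeE (k : ℕ) : Expr := .add (listD k).start (mulConst k (listD k).length)

/-- `e` holds for all vertices as value of variable `i`. -/
def allV (i : ℕ) (e : Expr) : Expr := all i (imp (lt (.var i) numE) e)

namespace IsInput

variable {n k b : ℕ} {LC LD : List (Finset (Fin n))} {m ρ : ℕ → ℕ}

theorem length_sets {L : List (Finset (Fin n))} (hL : ∀ T ∈ L, T.card = k) :
    (L.flatMap setCode).length = k * L.length :=
  List.length_flatMap_of_length_eq fun S hS => by rw [length_setCode, hL S hS]

/-- Where the list of the elements of all sets of `L` starts at address `p`, the sets are blocks. -/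
theorem isBlock_of_getD {L : List (Finset (Fin n))} (hL : ∀ T ∈ L, T.card = k) {p : ℕ}
    (hm : ∀ i < k * L.length, m (p + i) = (L.flatMap setCode).getD i 0)
    {j : ℕ} (hj : j < L.length) : IsBlock k m (p + k * j) L[j] := by
  have hc := hL L[j] (List.getElem_mem hj)
  refine ⟨L[j].orderEmbOfFin hc, ?_, fun a => ?_⟩
  · ext x
    simp
  · have hlt : k * j + a < k * L.length :=
      calc k * j + a < k * j + k := by have := a.2; lia
        _ = k * (j + 1) := by ring
        _ ≤ k * L.length := Nat.mul_le_mul_left k hj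
    rw [add_assoc, hm _ hlt, List.getD_eq_getElem?_getD,
      List.getElem?_flatMap_of_length_eq (fun S hS => by rw [length_setCode, hL S hS]) hj a.2,
      Finset.orderEmbOfFin_apply, setCode, List.getElem?_map,
      List.getElem?_eq_getElem (by simp [hc])]
    rfl

variable (h : IsInput k b LC LD m)
include h

theorem mem_zero : m 0 = n := by
  rw [h.mem_eq 0 (by simp only [inputLength]; lia)]
  rfl

theorem mem_one : m 1 = LC.length := by
  rw [h.mem_eq 1 (by simp only [inputLength]; lia)]
  rfl

theorem mem_left {i : ℕ} (hi : i < k * LC.length) : m (2 + i) =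
    (LC.flatMap setCode).getD i 0 := by
  rw [h.mem_eq _ (by simp only [inputLength]; lia), add_comm 2 i]
  simp only [encodeInput, encodeSets_eq, List.getD_cons_succ, List.cons_append]
  rw [List.getD_append _ _ _ _ (by rwa [length_sets h.card_left])]

theorem mem_length_right : m (2 + k * LC.length) = LD.length := by
  rw [h.mem_eq _ (by simp only [inputLength]; lia), add_comm 2]
  simp only [encodeInput, encodeSets_eq, List.getD_cons_succ, List.cons_append]
  rw [List.getD_append_right _ _ _ _ (by rw [length_sets h.card_left]), length_sets h.card_left]
  simp

theorem mem_right {i : ℕ} (hi : i < k * LD.length) : m (3 + k * LC.length + i) =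
    (LD.flatMap setCode).getD i 0 := by
  rw [h.mem_eq _ (by simp only [inputLength]; lia),
    show 3 + k * LC.length + i = k * LC.length + (i + 1) + 1 + 1 by lia]
  simp only [encodeInput, encodeSets_eq, List.getD_cons_succ, List.cons_append]
  rw [List.getD_append_right _ _ _ _ (by rw [length_sets h.card_left]; lia),
    length_sets h.card_left, Nat.add_sub_cancel_left, List.getD_cons_succ]

theorem eval_numE : numE.eval b m ρ = n := h.mem_zero

theorem represents_listC : listC.Represents k b m LC where
  length_eq _ := h.mem_one
  length_le := h.length_left_le
  isBlock _ hj := ⟨_, fun _ => rfl, isBlock_of_getD h.card_left (fun _ hi => h.mem_left hi) hj⟩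

theorem represents_listD : (listD k).Represents k b m LD where
  length_eq _ := by
    simp only [listD, listC, eval, eval_mulConst]
    rw [h.mem_one, h.mem_length_right]
  length_le := h.length_right_le
  isBlock _ hj := by
    simp only [listD, listC, eval, eval_mulConst]
    rw [h.mem_one]
    exact ⟨_, fun _ => rfl, isBlock_of_getD h.card_right (fun _ hi => h.mem_right hi) hj⟩

theorem eval_freeE : (freeE k).eval b m ρ = inputLength k LC LD := by
  rw [freeE, eval, eval_mulConst, h.represents_listD.length_eq]
  simp only [listD, listC, eval, eval_mulConst]
  rw [h.mem_one, inputLength]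

theorem holds_allV {i : ℕ} {e : Expr} {Q : Fin n → Prop}
    (he : ∀ v : Fin n, e.Holds b m (Function.update ρ i v) ↔ Q v) :
    (allV i e).Holds b m ρ ↔ ∀ v, Q v := by
  simp only [allV, holds_all, holds_imp, holds_lt, h.eval_numE, eval, Function.update_self]
  exact ⟨fun H v => (he v).1 (H v (v.2.trans_le h.le_bound) v.2),
    fun H x _ hx => (he ⟨x, hx⟩).2 (H ⟨x, hx⟩)⟩

/-- Writing to a free memory cell leaves the input intact. -/
theorem update {p x : ℕ} (hp : inputLength k LC LD ≤ p) :
    IsInput k b LC LD (Function.update m p x) where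
  le_bound := h.le_bound
  length_left_le := h.length_left_le
  length_right_le := h.length_right_le
  card_left := h.card_left
  card_right := h.card_right
  mem_eq i hi := by
    rw [Function.update_of_ne (by lia)]
    exact h.mem_eq i hi

end IsInput

end RAM

/-! ### Conditions on a graph that is given by an expression -/

/-- The cut criterion for connectivity of a set that is given by an enumeration. -/
theorem SimpleGraph.induce_image_connected_iff {V : Type*} [DecidableEq V] {k : ℕ}
    {G : SimpleGraph V} {f : Fin k → V} (hf : Function.Injective f) (hk : 0 < k) :
    (G.induce ((Finset.univ.image f : Finset V) : Set V)).Connected ↔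
      ∀ A : Finset (Fin k), A.Nonempty → A ≠ Finset.univ →
        ∃ a ∈ A, ∃ b, b ∉ A ∧ G.Adj (f a) (f b) := by
  rw [SimpleGraph.induce_connected_iff_cut]
  constructor
  · rintro ⟨-, h⟩ A hA hne
    obtain ⟨x, hx, y, hy, hyA, hxy⟩ := h (A.image f) (Finset.image_subset_image A.subset_univ)
      (hA.image f) fun heq => hne (Finset.image_injective hf heq)
    obtain ⟨a, ha, rfl⟩ := Finset.mem_image.1 hx
    obtain ⟨c, -, rfl⟩ := Finset.mem_image.1 hy
    exact ⟨a, ha, c, fun hc => hyA (Finset.mem_image_of_mem f hc), hxy⟩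
  · refine fun h => ⟨⟨f ⟨0, hk⟩, by simp⟩, fun B hB hne hBne => ?_⟩
    obtain ⟨A, -, rfl⟩ := Finset.subset_image_iff.1 hB
    obtain ⟨a, ha, b, hb, hab⟩ := h A (Finset.image_nonempty.1 hne) (by
      rintro rfl
      exact hBne rfl)
    exact ⟨f a, Finset.mem_image_of_mem f ha, f b, by simp,
      by rwa [hf.mem_finset_image], hab⟩

namespace RAM

open _root_.RAM.Expr

variable {n k b : ℕ} {LC LD : List (Finset (Fin n))}

/-- The expression `A`, evaluated on an intact input, says whether the vertices in the variables
`0` and `1` are adjacent in `G`. -/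
def Expresses (k b : ℕ) (LC LD : List (Finset (Fin n))) (A : Expr) (G : SimpleGraph (Fin n)) :
    Prop :=
  ∀ m, IsInput k b LC LD m → ∀ (ρ : ℕ → ℕ) (x y : Fin n), ρ 0 = x → ρ 1 = y →
    (A.Holds b m ρ ↔ G.Adj x y)

/-- Substitution of two vertices for the variables `0` and `1` of `A`. The expressions for the
vertices must not mention these variables. The variables of the conditions below are numbered from
`8` on; those from `2` to `7` are left to the bound variables of `A`. -/
def adjAt (A x y : Expr) : Expr := ex 0 (and (eq (.var 0) x) (ex 1 (and (eq (.var 1) y) A)))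

theorem Expresses.holds_adjAt {A : Expr} {G : SimpleGraph (Fin n)}
    (hA : Expresses k b LC LD A G) {m : ℕ → ℕ} (hm : IsInput k b LC LD m) {ρ : ℕ → ℕ} {e₁ e₂ : Expr}
    {x y : Fin n} (h₁ : ∀ r, e₁.eval b m (Function.update ρ 0 r) = x)
    (h₂ : ∀ r s, e₂.eval b m (Function.update (Function.update ρ 0 r) 1 s) = y) :
    (adjAt A e₁ e₂).Holds b m ρ ↔ G.Adj x y := by
  simp only [adjAt, holds_ex, holds_and, holds_eq, h₁, h₂, eval, Function.update_self]
  have key := hA m hm (Function.update (Function.update ρ 0 x) 1 y) x y (by simp) (by simp)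
  constructor
  · rintro ⟨r, -, rfl, s, -, rfl, h⟩
    exact key.1 h
  · exact fun h => ⟨x, x.2.trans_le hm.le_bound, rfl, y, y.2.trans_le hm.le_bound, rfl, key.2 h⟩

theorem Expresses.holds_adjAt_var {A : Expr} {G : SimpleGraph (Fin n)}
    (hA : Expresses k b LC LD A G) {m : ℕ → ℕ} (hm : IsInput k b LC LD m) {ρ : ℕ → ℕ} {i j : ℕ}
    (hi : 1 < i) (hj : 1 < j) {x y : Fin n} (hx : ρ i = x) (hy : ρ j = y) :
    (adjAt A (.var i) (.var j)).Holds b m ρ ↔ G.Adj x y := by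
  refine hA.holds_adjAt hm (fun r => ?_) fun r s => ?_
  · rw [eval, Function.update_of_ne (by lia), hx]
  · rw [eval, Function.update_of_ne (by lia), Function.update_of_ne (by lia), hy]

/-- The graph has no triangle. -/
def triangleFreeE (A : Expr) : Expr :=
  allV 8 (allV 9 (allV 10 (not (and (adjAt A (.var 8) (.var 9))
    (and (adjAt A (.var 8) (.var 10)) (adjAt A (.var 9) (.var 10)))))))

theorem Expresses.holds_triangleFreeE {A : Expr} {G : SimpleGraph (Fin n)}
    (hA : Expresses k b LC LD A G) {m : ℕ → ℕ} (hm : IsInput k b LC LD m) {ρ : ℕ → ℕ} :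
    (triangleFreeE A).Holds b m ρ ↔ G.CliqueFree 3 := by
  have : (triangleFreeE A).Holds b m ρ ↔
      ∀ x y z : Fin n, ¬ (G.Adj x y ∧ G.Adj x z ∧ G.Adj y z) := by
    refine hm.holds_allV fun x => hm.holds_allV fun y => hm.holds_allV fun z => ?_
    rw [holds_not, holds_and, holds_and,
      hA.holds_adjAt_var hm (x := x) (y := y) (by lia) (by lia) (by simp) (by simp),
      hA.holds_adjAt_var hm (x := x) (y := z) (by lia) (by lia) (by simp) (by simp),
      hA.holds_adjAt_var hm (x := y) (y := z) (by lia) (by lia) (by simp) (by simp)]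
  rw [this]
  constructor
  · intro h S hS
    obtain ⟨x, y, z, hxy, hxz, hyz, -⟩ := SimpleGraph.is3Clique_iff.1 hS
    exact h x y z ⟨hxy, hxz, hyz⟩
  · rintro h x y z ⟨hxy, hxz, hyz⟩
    exact h.not_adj_of_adj_of_adj hxy hxz hyz

open Classical in
/-- Set number `j` of the list `l` induces a connected subgraph: every cut is crossed by an edge.
The cuts of `k` elements are a fixed finite family. -/
noncomputable def connectedE (k : ℕ) (A : Expr) (l : ListExpr) (j : Expr) : Expr :=
  allOf fun S : Finset (Fin k) => if S.Nonempty ∧ S ≠ Finset.univ then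
    anyOf fun p : Fin k × Fin k => if p.1 ∈ S ∧ p.2 ∉ S then
      adjAt A (l.elem k j p.1) (l.elem k j p.2) else .const 0
  else .const 1

theorem Expresses.holds_connectedE {A : Expr} {G : SimpleGraph (Fin n)}
    (hA : Expresses k b LC LD A G) {m : ℕ → ℕ} (hm : IsInput k b LC LD m) (hk : 0 < k)
    {l : ListExpr} {L : List (Finset (Fin n))} (hl : l.Represents k b m L)
    (hL : ∀ T ∈ L, T.card = k) {ρ : ℕ → ℕ} {i j : ℕ} (hi : 1 < i)
    (hj : j < L.length) (hρ : ρ i = j) :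
    (connectedE k A l (.var i)).Holds b m ρ ↔ (G.induce (L[j] : Set (Fin n))).Connected := by
  obtain ⟨f, hf, hm'⟩ := hl.exists_elem hj
  have hinj : Function.Injective f := by
    have := Finset.card_image_iff.1 (show (Finset.univ.image f).card = Finset.univ.card by
      rw [hf, hL _ (List.getElem_mem hj), Finset.card_fin])
    exact fun x y hxy => this (by simp) (by simp) hxy
  rw [← hf, SimpleGraph.induce_image_connected_iff hinj hk, connectedE, holds_allOf]
  refine forall_congr' fun S => ?_
  by_cases hS : S.Nonempty ∧ S ≠ Finset.univ
  · rw [if_pos hS, holds_anyOf]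
    have key : ∀ p : Fin k × Fin k, (adjAt A (l.elem k (.var i) p.1)
        (l.elem k (.var i) p.2)).Holds b m ρ ↔ G.Adj (f p.1) (f p.2) := by
      refine fun p => hA.holds_adjAt hm (fun r => hm' _ _ ?_ _) fun r s => hm' _ _ ?_ _
      · rw [eval, Function.update_of_ne (by lia), hρ]
      · rw [eval, Function.update_of_ne (by lia), Function.update_of_ne (by lia), hρ]
    constructor
    · rintro ⟨p, hp⟩ - -
      split at hp
      · next hpS => exact ⟨p.1, hpS.1, p.2, hpS.2, (key p).1 hp⟩
      · simp [holds_const] at hp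
    · intro H
      obtain ⟨a, ha, c, hc, hac⟩ := H hS.1 hS.2
      exact ⟨(a, c), by rw [if_pos ⟨ha, hc⟩]; exact (key (a, c)).2 hac⟩
  · rw [if_neg hS]
    simp only [holds_const, ne_eq, one_ne_zero, not_false_eq_true, true_iff]
    exact fun h1 h2 => absurd ⟨h1, h2⟩ hS

/-- The connected and disconnected `k`-sets of the graph are those in the input. -/
noncomputable def consistentE (k : ℕ) (A : Expr) : Expr :=
  and (listC.allE 8 (connectedE k A listC (.var 8)))
    ((listD k).allE 8 (not (connectedE k A (listD k) (.var 8))))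

theorem Expresses.holds_consistentE {A : Expr} {G : SimpleGraph (Fin n)}
    (hA : Expresses k b LC LD A G) {m : ℕ → ℕ} (hm : IsInput k b LC LD m) (hk : 0 < k)
    {C D : Finset (Finset (Fin n))} (hCD : IsCompleteKSets k C D) (hC : ∀ S, S ∈ LC ↔ S ∈ C)
    (hD : ∀ S, S ∈ LD ↔ S ∈ D) {ρ : ℕ → ℕ} :
    (consistentE k A).Holds b m ρ ↔ IsConsistent k C D G := by
  have hleft : (listC.allE 8 (connectedE k A listC (.var 8))).Holds b m ρ ↔
      ∀ T ∈ LC, (G.induce (T : Set (Fin n))).Connected :=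
    hm.represents_listC.holds_allE fun j hj =>
      hA.holds_connectedE hm hk hm.represents_listC hm.card_left (by lia) hj
        (Function.update_self ..)
  have hright : ((listD k).allE 8 (not (connectedE k A (listD k) (.var 8)))).Holds b m ρ ↔
      ∀ T ∈ LD, ¬ (G.induce (T : Set (Fin n))).Connected :=
    hm.represents_listD.holds_allE (Q := fun T => ¬ (G.induce (T : Set (Fin n))).Connected)
      fun j hj => holds_not.trans (not_congr
        (hA.holds_connectedE hm hk hm.represents_listD hm.card_right (by lia) hj
          (Function.update_self ..)))
  rw [consistentE, holds_and, hleft, hright]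
  simp only [hC, hD]
  constructor
  · rintro ⟨h1, h2⟩
    constructor
    · ext S
      simp only [connectedKSets, Set.mem_ofPred_eq, Finset.mem_coe]
      refine ⟨fun ⟨hS, hc⟩ => ((hCD.mem_iff S).2 hS).resolve_right fun h => h2 S h hc,
        fun h => ⟨(hCD.mem_iff S).1 (Or.inl h), h1 S h⟩⟩
    · ext S
      simp only [disconnectedKSets, Set.mem_ofPred_eq, Finset.mem_coe]
      refine ⟨fun ⟨hS, hc⟩ => ((hCD.mem_iff S).2 hS).resolve_left fun h => hc (h1 S h),
        fun h => ⟨(hCD.mem_iff S).1 (Or.inr h), h2 S h⟩⟩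
  · exact fun h => ⟨fun T hT => (h.mem_left_iff.1 hT).2, fun T hT => (h.mem_right_iff.1 hT).2⟩

/-! ### Connectivity of the whole graph -/

theorem Stmt.iter_induction {f : ℕ → State → State} {c : ℕ} {σ : State} (P : ℕ → State → Prop)
    (h0 : P 0 σ) (hs : ∀ x < c, ∀ τ, P x τ → P (x + 1) (f x τ)) : P c (Stmt.iter f c σ) := by
  induction c with
  | zero => exact h0
  | succ c ih =>
    exact hs c (Nat.lt_succ_self c) _ (ih fun x hx => hs x (hx.trans (Nat.lt_succ_self c)))

/-- The memory cell for the mark of a vertex. -/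
def markE (k : ℕ) (x : Expr) : Expr := .add (freeE k) x

/-- Mark vertex `0` and no other. -/
def resetMarks (k : ℕ) : Stmt := .loop 8 (.write (markE k (.var 8)) (eq (.var 8) (.const 0)))

/-- Mark vertex `9` if vertex `8` is marked and adjacent to it. -/
def spreadMark (k : ℕ) (A : Expr) : Stmt :=
  .ite (and (and (lt (.var 8) numE) (lt (.var 9) numE))
      (and (.read (markE k (.var 8))) (adjAt A (.var 8) (.var 9))))
    (.write (markE k (.var 9)) (.const 1)) .skip

/-- Mark all neighbours of the marked vertices. -/
def spreadMarks (k : ℕ) (A : Expr) : Stmt := .loop 8 (.loop 9 (spreadMark k A))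

/-- Mark all vertices that can be reached from vertex `0`. -/
def markComponent (k : ℕ) (A : Expr) : Stmt := .seq (resetMarks k) (.loop 10 (spreadMarks k A))

/-- In the state `σ`, vertex `x` is marked. -/
def Marked (k : ℕ) (LC LD : List (Finset (Fin n))) (σ : State) (x : ℕ) : Prop :=
  σ.mem (inputLength k LC LD + x) ≠ 0

/-- Nothing but the marks has changed since the beginning, and only vertices reachable from vertex
`0` are marked. -/
structure MarksSound (k b : ℕ) (LC LD : List (Finset (Fin n))) (G : SimpleGraph (Fin n))
    (o : List ℕ) (σ : State) : Prop where
  isInput : IsInput k b LC LD σ.mem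
  out : σ.out = o
  reachable : ∀ x y : Fin n, (x : ℕ) = 0 → Marked k LC LD σ y → G.Reachable x y

theorem MarksSound.set {G : SimpleGraph (Fin n)} {o : List ℕ} {σ : State}
    (h : MarksSound k b LC LD G o σ) (i x : ℕ) : MarksSound k b LC LD G o (σ.set i x) :=
  ⟨h.isInput, h.out, h.reachable⟩

theorem Marked.set {σ : State} {x : ℕ} (h : Marked k LC LD σ x) (i y : ℕ) :
    Marked k LC LD (σ.set i y) x := h

theorem eval_resetMarks {G : SimpleGraph (Fin n)} {σ : State} (hσ : IsInput k b LC LD σ.mem) :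
    MarksSound k b LC LD G σ.out ((resetMarks k).eval b σ) ∧
      ∀ x : Fin n, (x : ℕ) = 0 → Marked k LC LD ((resetMarks k).eval b σ) x := by
  have key : ∀ τ : State, τ = (resetMarks k).eval b σ → IsInput k b LC LD τ.mem ∧ τ.out = σ.out ∧
      ∀ y < b, Marked k LC LD τ y ↔ y = 0 := by
    rintro τ rfl
    rw [resetMarks, Stmt.eval]
    refine Stmt.iter_induction (fun c τ => IsInput k b LC LD τ.mem ∧ τ.out = σ.out ∧
      ∀ y < c, Marked k LC LD τ y ↔ y = 0) ⟨hσ, rfl, by simp⟩ ?_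
    rintro x hx τ ⟨h1, h2, h3⟩
    have ha : (τ.set 8 x).val b (markE k (.var 8)) = inputLength k LC LD + x := by
      rw [State.val, markE, Expr.eval, IsInput.eval_freeE (by exact h1)]
      simp [State.set, Expr.eval]
    have hv : (τ.set 8 x).val b (eq (.var 8) (.const 0)) ≠ 0 ↔ x = 0 := by
      refine holds_eq.trans ?_
      simp [State.set, Expr.eval]
    refine ⟨?_, h2, fun y hy => ?_⟩
    · simp only [Stmt.eval, ha]
      exact h1.update (by lia)
    · simp only [Stmt.eval, ha, Marked, Function.update_apply, add_right_inj]
      split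
      · next hyx => rw [hv, hyx]
      · exact h3 y (by lia)
  obtain ⟨h1, h2, h3⟩ := key _ rfl
  have hnb := hσ.le_bound
  refine ⟨⟨h1, h2, fun x y hx hy => ?_⟩, fun x hx => (h3 x (by lia)).2 hx⟩
  rw [h3 y (by lia)] at hy
  rw [show x = y from Fin.ext (by lia)]

theorem Expresses.eval_spreadMark {A : Expr} {G : SimpleGraph (Fin n)}
    (hA : Expresses k b LC LD A G) {o : List ℕ} {σ : State} (h : MarksSound k b LC LD G o σ)
    {x y : ℕ} (hx : σ.var 8 = x) (hy : σ.var 9 = y) :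
    MarksSound k b LC LD G o ((spreadMark k A).eval b σ) ∧
      ((spreadMark k A).eval b σ).var = σ.var ∧
      (∀ z, Marked k LC LD σ z → Marked k LC LD ((spreadMark k A).eval b σ) z) ∧
      ∀ u v : Fin n, (u : ℕ) = x → (v : ℕ) = y → G.Adj u v → Marked k LC LD σ u →
        Marked k LC LD ((spreadMark k A).eval b σ) v := by
  have hread : ∀ e : Expr, (markE k e).eval b σ.mem σ.var =
      inputLength k LC LD + e.eval b σ.mem σ.var := by
    intro e
    rw [markE, Expr.eval, h.isInput.eval_freeE]
  have hcond : σ.val b (and (and (lt (.var 8) numE) (lt (.var 9) numE))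
      (and (.read (markE k (.var 8))) (adjAt A (.var 8) (.var 9)))) ≠ 0 ↔
      ∃ u v : Fin n, (u : ℕ) = x ∧ (v : ℕ) = y ∧ Marked k LC LD σ u ∧ G.Adj u v := by
    refine holds_and.trans ?_
    rw [holds_and, holds_and, holds_lt, holds_lt, h.isInput.eval_numE]
    have hm : (Expr.read (markE k (.var 8))).Holds b σ.mem σ.var ↔ Marked k LC LD σ x := by
      rw [Holds, Expr.eval, hread, Expr.eval, hx, Marked]
    rw [hm]
    simp only [Expr.eval, hx, hy]
    constructor
    · rintro ⟨⟨hxn, hyn⟩, hmx, hxy⟩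
      exact ⟨⟨x, hxn⟩, ⟨y, hyn⟩, rfl, rfl, hmx,
        (hA.holds_adjAt_var h.isInput (by lia) (by lia) hx hy).1 hxy⟩
    · rintro ⟨u, v, rfl, rfl, hmx, huv⟩
      exact ⟨⟨u.2, v.2⟩, hmx, (hA.holds_adjAt_var h.isInput (by lia) (by lia) hx hy).2 huv⟩
  rw [spreadMark, Stmt.eval]
  split
  · next hc =>
    obtain ⟨u, v, rfl, rfl, hmu, huv⟩ := hcond.1 hc
    simp only [Stmt.eval, State.val, hread, Expr.eval, hy]
    refine ⟨⟨h.isInput.update (by lia), h.out, fun p q hp hq => ?_⟩, trivial, fun z hz => ?_, ?_⟩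
    · simp only [Marked, Function.update_apply, add_right_inj] at hq
      split at hq
      · next hqv =>
        rw [Fin.ext hqv]
        exact (h.reachable p u hp hmu).trans huv.reachable
      · exact h.reachable p q hp hq
    · simp only [Marked, Function.update_apply, add_right_inj]
      split
      · exact one_ne_zero
      · exact hz
    · intro u' v' _ hv' _ _
      simp [Marked, hv']
  · next hc =>
    refine ⟨h, rfl, fun z hz => hz, fun u v hu hv huv hm => ?_⟩
    exact absurd (hcond.2 ⟨u, v, hu, hv, hm, huv⟩) hc

theorem Expresses.eval_spreadMarks {A : Expr} {G : SimpleGraph (Fin n)}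
    (hA : Expresses k b LC LD A G) (hnb : n ≤ b) {o : List ℕ} {σ : State}
    (h : MarksSound k b LC LD G o σ) :
    MarksSound k b LC LD G o ((spreadMarks k A).eval b σ) ∧
      (∀ z, Marked k LC LD σ z → Marked k LC LD ((spreadMarks k A).eval b σ) z) ∧
      ∀ u v : Fin n, G.Adj u v → Marked k LC LD σ u →
        Marked k LC LD ((spreadMarks k A).eval b σ) v := by
  have key : MarksSound k b LC LD G o ((spreadMarks k A).eval b σ) ∧
      (∀ z, Marked k LC LD σ z → Marked k LC LD ((spreadMarks k A).eval b σ) z) ∧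
      ∀ u v : Fin n, (u : ℕ) < b → G.Adj u v → Marked k LC LD σ u →
        Marked k LC LD ((spreadMarks k A).eval b σ) v := by
    rw [spreadMarks, Stmt.eval]
    refine Stmt.iter_induction (fun c τ => MarksSound k b LC LD G o τ ∧
      (∀ z, Marked k LC LD σ z → Marked k LC LD τ z) ∧
      ∀ u v : Fin n, (u : ℕ) < c → G.Adj u v → Marked k LC LD σ u → Marked k LC LD τ v)
      ⟨h, fun _ hz => hz, by simp⟩ ?_
    rintro x hx τ ⟨h1, h2, h3⟩
    have inner : ∀ τ', τ' = (Stmt.loop 9 (spreadMark k A)).eval b (τ.set 8 x) →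
        MarksSound k b LC LD G o τ' ∧ τ'.var 8 = x ∧
        (∀ z, Marked k LC LD τ z → Marked k LC LD τ' z) ∧
        ∀ u v : Fin n, (u : ℕ) = x → (v : ℕ) < b → G.Adj u v → Marked k LC LD τ u →
          Marked k LC LD τ' v := by
      rintro τ' rfl
      rw [Stmt.eval]
      refine Stmt.iter_induction (fun c τ' => MarksSound k b LC LD G o τ' ∧ τ'.var 8 = x ∧
        (∀ z, Marked k LC LD τ z → Marked k LC LD τ' z) ∧
        ∀ u v : Fin n, (u : ℕ) = x → (v : ℕ) < c → G.Adj u v → Marked k LC LD τ u →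
          Marked k LC LD τ' v) ⟨h1.set 8 x, by simp [State.set], fun _ hz => hz, by simp⟩ ?_
      rintro y hy τ' ⟨g1, g2, g3, g4⟩
      obtain ⟨f1, f2, f3, f4⟩ := hA.eval_spreadMark (g1.set 9 y) (x := x) (y := y)
        (by simp [State.set, g2]) (by simp [State.set])
      refine ⟨f1, by rw [f2]; simp [State.set, g2], fun z hz => f3 z (g3 z hz), ?_⟩
      intro u v hu hv huv hm
      rcases Nat.lt_succ_iff_lt_or_eq.1 hv with hv | hv
      · exact f3 v (g4 u v hu hv huv hm)
      · exact f4 u v hu hv huv (g3 u hm)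
    obtain ⟨g1, -, g3, g4⟩ := inner _ rfl
    refine ⟨g1, fun z hz => g3 z (h2 z hz), fun u v hu huv hm => ?_⟩
    rcases Nat.lt_succ_iff_lt_or_eq.1 hu with hu | hu
    · exact g3 v (h3 u v hu huv hm)
    · exact g4 u v hu (v.2.trans_le hnb) huv (h2 u hm)
  exact ⟨key.1, key.2.1, fun u v => key.2.2 u v (u.2.trans_le hnb)⟩

/-- After `b ≥ n` rounds, the marked vertices are those reachable from vertex `0`. -/
theorem Expresses.eval_markComponent {A : Expr} {G : SimpleGraph (Fin n)}
    (hA : Expresses k b LC LD A G) {σ : State} (hσ : IsInput k b LC LD σ.mem) :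
    MarksSound k b LC LD G σ.out ((markComponent k A).eval b σ) ∧
      ∀ x y : Fin n, (x : ℕ) = 0 →
        (Marked k LC LD ((markComponent k A).eval b σ) y ↔ G.Reachable x y) := by
  have key : MarksSound k b LC LD G σ.out ((markComponent k A).eval b σ) ∧
      ∀ x y : Fin n, (x : ℕ) = 0 → (∃ p : G.Walk x y, p.length ≤ b) →
        Marked k LC LD ((markComponent k A).eval b σ) y := by
    rw [markComponent, Stmt.eval, Stmt.eval]
    obtain ⟨h1, h2⟩ := eval_resetMarks (G := G) hσ
    refine Stmt.iter_induction (fun c τ => MarksSound k b LC LD G σ.out τ ∧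
      ∀ x y : Fin n, (x : ℕ) = 0 → (∃ p : G.Walk x y, p.length ≤ c) → Marked k LC LD τ y)
      ⟨h1, ?_⟩ ?_
    · rintro x y hx ⟨p, hp⟩
      rw [← p.eq_of_length_eq_zero (by lia)]
      exact h2 x hx
    · rintro c - τ ⟨g1, g2⟩
      obtain ⟨f1, f2, f3⟩ := hA.eval_spreadMarks hσ.le_bound (g1.set 10 c)
      refine ⟨f1, ?_⟩
      rintro x y hx ⟨p, hp⟩
      rcases hq : p.reverse with _ | ⟨hyz, q⟩
      · exact f2 _ ((g2 x x hx ⟨.nil, by simp⟩).set 10 c)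
      · have hlen : q.length + 1 = p.length := by
          rw [← p.length_reverse, hq, SimpleGraph.Walk.length_cons]
        exact f3 _ _ hyz.symm ((g2 x _ hx ⟨q.reverse, by simp; lia⟩).set 10 c)
  refine ⟨key.1, fun x y hx => ⟨key.1.reachable x y hx, fun hxy => ?_⟩⟩
  obtain ⟨p, hp⟩ := hxy.exists_isPath
  have := hp.length_lt
  rw [Fintype.card_fin] at this
  exact key.2 x y hx ⟨p, (this.trans_le hσ.le_bound).le⟩

end RAM

/-! ### Output of a graph -/

theorem List.flatMap_range_eq_flatMap_finRange {α : Type*} {n b : ℕ} (h : n ≤ b)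
    (f : Fin n → List α) :
    (List.range b).flatMap (fun x => if hx : x < n then f ⟨x, hx⟩ else []) =
      (List.finRange n).flatMap f := by
  obtain ⟨c, rfl⟩ := Nat.exists_eq_add_of_le h
  rw [List.range_add, List.flatMap_append, ← List.map_coe_finRange_eq_range, List.flatMap_map,
    List.flatMap_map]
  simp

theorem List.flatMap_ite_eq_flatMap_filter {α β : Type*} (l : List α) (p : α → Prop)
    [DecidablePred p]
    (f : α → List β) :
    (l.flatMap fun x => if p x then f x else []) = (l.filter fun x => p x).flatMap f := by
  induction l with
  | nil => rfl
  | cons x l ih =>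
    rw [List.flatMap_cons, ih, List.filter_cons]
    by_cases hx : p x <;> simp [hx]

namespace RAM

open _root_.RAM.Expr

variable {n k b : ℕ} {LC LD : List (Finset (Fin n))}

/-- The output of a loop is the concatenation of the outputs of its iterations. -/
theorem Stmt.iter_out {f : ℕ → State → State} {c : ℕ} {σ : State} (R : State → Prop)
    (g : ℕ → List ℕ) (h0 : R σ)
    (hs : ∀ x < c, ∀ τ, R τ → R (f x τ) ∧ (f x τ).out = τ.out ++ g x) :
    R (Stmt.iter f c σ) ∧ (Stmt.iter f c σ).out = σ.out ++ (List.range c).flatMap g := by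
  refine Stmt.iter_induction (fun c τ => R τ ∧ τ.out = σ.out ++ (List.range c).flatMap g)
    ⟨h0, by simp⟩ ?_
  rintro x hx τ ⟨h1, h2⟩
  obtain ⟨h3, h4⟩ := hs x hx τ h1
  exact ⟨h3, by rw [h4, h2, List.range_succ]; simp⟩

/-- Output the adjacency matrix. -/
def emitGraph (A : Expr) : Stmt :=
  .loop 8 (.loop 9 (.ite (and (lt (.var 8) numE) (lt (.var 9) numE))
    (.emit (not (not (adjAt A (.var 8) (.var 9))))) .skip))

theorem Expresses.eval_emitGraph {A : Expr} {G : SimpleGraph (Fin n)}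
    (hA : Expresses k b LC LD A G) {σ : State} (hσ : IsInput k b LC LD σ.mem) :
    IsInput k b LC LD ((emitGraph A).eval b σ).mem ∧
      ((emitGraph A).eval b σ).out = σ.out ++ encodeGraph G := by
  classical
  have hnb := hσ.le_bound
  rw [encodeGraph, ← List.flatMap_range_eq_flatMap_finRange hnb, emitGraph, Stmt.eval]
  refine Stmt.iter_out (fun τ => IsInput k b LC LD τ.mem) _ hσ fun x hx τ hτ => ?_
  have inner : ∀ τ', τ' = Stmt.eval b (.loop 9 (.ite (and (lt (.var 8) numE) (lt (.var 9) numE))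
      (.emit (not (not (adjAt A (.var 8) (.var 9))))) .skip)) (τ.set 8 x) →
      (IsInput k b LC LD τ'.mem ∧ τ'.var 8 = x) ∧ τ'.out = τ.out ++ (List.range b).flatMap
        fun y => if hy : y < n then (if hx : x < n then
          [if G.Adj ⟨x, hx⟩ ⟨y, hy⟩ then 1 else 0] else []) else [] := by
    rintro τ' rfl
    rw [Stmt.eval]
    refine Stmt.iter_out (σ := τ.set 8 x) (fun τ => IsInput k b LC LD τ.mem ∧ τ.var 8 = x) _
      ⟨hτ, by simp [State.set]⟩ ?_
    rintro y hy τ' ⟨h1, h2⟩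
    have h8 : (τ'.set 9 y).var 8 = x := by simp [State.set, h2]
    have h9 : (τ'.set 9 y).var 9 = y := by simp [State.set]
    have h1' : IsInput k b LC LD (τ'.set 9 y).mem := h1
    have hcond : (τ'.set 9 y).val b (and (lt (.var 8) numE) (lt (.var 9) numE)) ≠ 0 ↔
        x < n ∧ y < n := by
      refine holds_and.trans ?_
      rw [holds_lt, holds_lt, h1'.eval_numE]
      simp only [Expr.eval, h8, h9]
    rw [Stmt.eval]
    by_cases hc : x < n ∧ y < n
    · rw [if_pos (hcond.2 hc), dif_pos hc.2, dif_pos hc.1]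
      refine ⟨⟨h1', h8⟩, ?_⟩
      have hadj := hA.holds_adjAt_var h1' (i := 8) (j := 9) (by lia) (by lia)
        (x := ⟨x, hc.1⟩) (y := ⟨y, hc.2⟩) h8 h9
      have hval : (τ'.set 9 y).val b (not (not (adjAt A (.var 8) (.var 9)))) =
          if G.Adj ⟨x, hc.1⟩ ⟨y, hc.2⟩ then 1 else 0 := by
        simp only [State.val, eval_not]
        simp only [Holds] at hadj
        split
        · next h => have := hadj.2 h; lia
        · next h => have := not_imp_not.2 hadj.1 h; lia
      simp only [Stmt.eval, hval]
      rfl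
    · rw [if_neg fun h => hc (hcond.1 h)]
      refine ⟨⟨h1', h8⟩, ?_⟩
      have : (if hy : y < n then (if hx : x < n then
          [if G.Adj ⟨x, hx⟩ ⟨y, hy⟩ then 1 else 0] else []) else []) = ([] : List ℕ) := by
        split
        · next hy => rw [dif_neg fun hx => hc ⟨hx, hy⟩]
        · rfl
      rw [this, List.append_nil]
      rfl
  obtain ⟨⟨h1, -⟩, h2⟩ := inner _ rfl
  refine ⟨h1, h2.trans ?_⟩
  congr 1
  rw [List.flatMap_range_eq_flatMap_finRange hnb fun y : Fin n => if hx : x < n then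
    [if G.Adj ⟨x, hx⟩ y then 1 else 0] else []]
  split
  · exact List.map_eq_flatMap.symm
  · simp

/-! ### Checking a candidate -/

/-- All vertices are marked, and there is a vertex. -/
def allMarkedE (k : ℕ) : Expr := and numE (allV 8 (.read (markE k (.var 8))))

/-- Output the graph that is given by `A` if it is connected, triangle-free and consistent. -/
noncomputable def checkAndEmit (k : ℕ) (A : Expr) : Stmt :=
  .seq (markComponent k A) (.ite (and (allMarkedE k) (and (triangleFreeE A) (consistentE k A)))
    (emitGraph A) .skip)

/-- `G` is connected, triangle-free and consistent with the two families. -/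
def IsSolution (k : ℕ) (C D : Finset (Finset (Fin n))) (G : SimpleGraph (Fin n)) : Prop :=
  G.Connected ∧ G.CliqueFree 3 ∧ IsConsistent k C D G

theorem Expresses.eval_checkAndEmit {A : Expr} {G : SimpleGraph (Fin n)}
    (hA : Expresses k b LC LD A G) (hk : 0 < k) {C D : Finset (Finset (Fin n))}
    [Decidable (IsSolution k C D G)] (hCD : IsCompleteKSets k C D) (hC : ∀ S, S ∈ LC ↔ S ∈ C)
    (hD : ∀ S, S ∈ LD ↔ S ∈ D) {σ : State} (hσ : IsInput k b LC LD σ.mem) :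
    IsInput k b LC LD ((checkAndEmit k A).eval b σ).mem ∧
      ((checkAndEmit k A).eval b σ).out = σ.out ++
        if IsSolution k C D G then encodeGraph G else [] := by
  obtain ⟨h1, h2⟩ := hA.eval_markComponent hσ
  set τ := (markComponent k A).eval b σ with hτ
  have hconn : (allMarkedE k).Holds b τ.mem τ.var ↔ G.Connected := by
    have hall : (allV 8 (.read (markE k (.var 8)))).Holds b τ.mem τ.var ↔
        ∀ y : Fin n, Marked k LC LD τ y := by
      refine h1.isInput.holds_allV fun y => ?_
      rw [Holds, Expr.eval, markE, Expr.eval, h1.isInput.eval_freeE, Expr.eval,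
        Function.update_self, Marked]
    rw [allMarkedE, holds_and, hall, Holds, h1.isInput.eval_numE]
    constructor
    · rintro ⟨hn, h⟩
      rw [SimpleGraph.connected_iff_exists_forall_reachable]
      exact ⟨⟨0, by lia⟩, fun y => (h2 _ y rfl).1 (h y)⟩
    · intro h
      obtain ⟨x⟩ := h.nonempty
      have hn : 0 < n := x.pos
      exact ⟨by lia, fun y => (h2 ⟨0, hn⟩ y rfl).2 (h.preconnected _ _)⟩
  have hcond : τ.val b (and (allMarkedE k) (and (triangleFreeE A) (consistentE k A))) ≠ 0 ↔
      IsSolution k C D G := by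
    refine holds_and.trans ?_
    rw [holds_and, hconn, hA.holds_triangleFreeE h1.isInput,
      hA.holds_consistentE h1.isInput hk hCD hC hD, IsSolution]
  rw [checkAndEmit, Stmt.eval, Stmt.eval, ← hτ]
  by_cases hG : IsSolution k C D G
  · rw [if_pos (hcond.2 hG), if_pos hG, ← h1.out]
    exact hA.eval_emitGraph h1.isInput
  · rw [if_neg fun h => hG (hcond.1 h), if_neg hG, List.append_nil]
    exact ⟨h1.isInput, h1.out⟩

/-! ### Candidates for large graphs -/

/-- The path rule for the vertices in the variables `u` and `v`. -/
noncomputable def pathRuleE (k u v : ℕ) : Expr :=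
  listC.exE 2 (and
    (listC.allE 3 (imp
      (listC.ballE k (.var 3) fun x => or (eq x (.var v)) (listC.memE k (.var 2) x))
      (not (listC.memE k (.var 3) (.var v)))))
    (listC.exE 3 (and (listC.memE k (.var 3) (.var v))
      (listC.ballE k (.var 3) fun x =>
        or (eq x (.var u)) (or (eq x (.var v)) (listC.memE k (.var 2) x))))))

/-- The star rule for the vertices in the variables `u` and `v`. -/
noncomputable def starRuleE (k u v : ℕ) : Expr :=
  (listD k).exE 2 ((listD k).exE 4 (and
    ((listD k).ballE k (.var 2) fun x => not ((listD k).memE k (.var 4) x))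
    (and ((listD k).memE k (.var 2) (.var v))
    (and (listC.allE 3 (imp
        (listC.ballE k (.var 3) fun x =>
          or (eq x (.var u)) (or ((listD k).memE k (.var 2) x) ((listD k).memE k (.var 4) x)))
        (listC.memE k (.var 3) (.var u))))
      ((listD k).allE 3 (imp
        ((listD k).ballE k (.var 3) fun x =>
          or (eq x (.var u)) (or ((listD k).memE k (.var 2) x) ((listD k).memE k (.var 4) x)))
        (not ((listD k).memE k (.var 3) (.var u)))))))))

/-- Adjacency in the graph that the two rules describe. -/
noncomputable def ruleE (k : ℕ) : Expr :=
  and (not (eq (.var 0) (.var 1)))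
    (or (or (pathRuleE k 0 1) (starRuleE k 0 1)) (or (pathRuleE k 1 0) (starRuleE k 1 0)))

section

variable {m ρ : ℕ → ℕ} {C D : Finset (Finset (Fin n))}

theorem IsInput.holds_pathRuleE (h : IsInput k b LC LD m) (hC : ∀ S, S ∈ LC ↔ S ∈ C) {u v : ℕ}
    (hu : u < 2) (hv : v < 2) {x y : Fin n} (hx : ρ u = x) (hy : ρ v = y) :
    (pathRuleE k u v).Holds b m ρ ↔ PathRule C x y := by
  have hl := h.represents_listC
  simp only [PathRule, ← hC]
  refine hl.holds_exE (Q := fun B => (∀ T ∈ LC, T ⊆ insert y B → y ∉ T) ∧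
    ∃ T ∈ LC, y ∈ T ∧ T ⊆ insert x (insert y B)) fun i hi => holds_and.trans (and_congr ?_ ?_)
  · refine hl.holds_allE (Q := fun T => T ⊆ insert y LC[i] → y ∉ T) fun j hj =>
      holds_imp.trans (imp_congr ?_ ?_)
    · refine hl.holds_ballE hj (by simp [Expr.eval]) (Q := fun w => w ∈ insert y LC[i])
        fun e w hw => ?_
      rw [holds_or, holds_eq, hw, hl.holds_memE hi (by simp [Expr.eval]) hw, Finset.mem_insert,
        Expr.eval, Function.update_of_ne (by lia), Function.update_of_ne (by lia), hy, Fin.ext_iff]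
    · rw [holds_not, hl.holds_memE hj (by simp [Expr.eval]) (v := y)]
      rw [Expr.eval, Function.update_of_ne (by lia), Function.update_of_ne (by lia), hy]
  · refine hl.holds_exE (Q := fun T => y ∈ T ∧ T ⊆ insert x (insert y LC[i])) fun j hj =>
      holds_and.trans (and_congr ?_ ?_)
    · refine hl.holds_memE hj (by simp [Expr.eval]) ?_
      rw [Expr.eval, Function.update_of_ne (by lia), Function.update_of_ne (by lia), hy]
    · refine hl.holds_ballE hj (by simp [Expr.eval])
        (Q := fun w => w ∈ insert x (insert y LC[i])) fun e w hw => ?_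
      rw [holds_or, holds_or, holds_eq, holds_eq, hw, hl.holds_memE hi (by simp [Expr.eval]) hw,
        Finset.mem_insert, Finset.mem_insert, Expr.eval, Expr.eval,
        Function.update_of_ne (by lia), Function.update_of_ne (by lia), hx,
        Function.update_of_ne (by lia), Function.update_of_ne (by lia), hy, Fin.ext_iff,
        Fin.ext_iff]

theorem IsInput.holds_starRuleE (h : IsInput k b LC LD m) (hC : ∀ S, S ∈ LC ↔ S ∈ C)
    (hD : ∀ S, S ∈ LD ↔ S ∈ D) {u v : ℕ} (hu : u < 2) (hv : v < 2) {x y : Fin n} (hx : ρ u = x)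
    (hy : ρ v = y) : (starRuleE k u v).Holds b m ρ ↔ StarRule C D x y := by
  have hlC := h.represents_listC
  have hlD := h.represents_listD
  simp only [StarRule, ← hC, ← hD]
  refine hlD.holds_exE (Q := fun T₁ => ∃ T₂ ∈ LD, Disjoint T₁ T₂ ∧ y ∈ T₁ ∧
    (∀ T ∈ LC, T ⊆ insert x (T₁ ∪ T₂) → x ∈ T) ∧ ∀ T ∈ LD, T ⊆ insert x (T₁ ∪ T₂) → x ∉ T)
    fun i hi => ?_
  refine hlD.holds_exE (Q := fun T₂ => Disjoint LD[i] T₂ ∧ y ∈ LD[i] ∧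
    (∀ T ∈ LC, T ⊆ insert x (LD[i] ∪ T₂) → x ∈ T) ∧ ∀ T ∈ LD, T ⊆ insert x (LD[i] ∪ T₂) → x ∉ T)
    fun j hj => ?_
  rw [holds_and, holds_and, holds_and]
  have sub : ∀ (l : ℕ) (e : Expr) (w : Fin n), e.eval b m
      (Function.update (Function.update (Function.update ρ 2 i) 4 j) 3 l) = w →
      ((or (eq e (.var u)) (or ((listD k).memE k (.var 2) e) ((listD k).memE k (.var 4) e))).Holds
        b m (Function.update (Function.update (Function.update ρ 2 i) 4 j) 3 l) ↔
        w ∈ insert x (LD[i] ∪ LD[j])) := by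
    intro l e w hw
    rw [holds_or, holds_or, holds_eq, hw, hlD.holds_memE hi (by simp [Expr.eval]) hw,
      hlD.holds_memE hj (by simp [Expr.eval]) hw, Finset.mem_insert, Finset.mem_union, Expr.eval,
      Function.update_of_ne (by lia), Function.update_of_ne (by lia),
      Function.update_of_ne (by lia), hx, Fin.ext_iff]
  have hux : ∀ l : ℕ, (Expr.var u).eval b m
      (Function.update (Function.update (Function.update ρ 2 i) 4 j) 3 l) = x := by
    intro l
    rw [Expr.eval, Function.update_of_ne (by lia), Function.update_of_ne (by lia),
      Function.update_of_ne (by lia), hx]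
  refine and_congr ?_ (and_congr ?_ (and_congr ?_ ?_))
  · rw [Finset.disjoint_left]
    refine hlD.holds_ballE hi (by simp [Expr.eval]) fun e w hw => ?_
    rw [holds_not, hlD.holds_memE hj (by simp [Expr.eval]) hw]
  · refine hlD.holds_memE hi (by simp [Expr.eval]) ?_
    rw [Expr.eval, Function.update_of_ne (by lia), Function.update_of_ne (by lia), hy]
  · refine hlC.holds_allE (Q := fun T => T ⊆ insert x (LD[i] ∪ LD[j]) → x ∈ T) fun l hl =>
      holds_imp.trans (imp_congr ?_ ?_)
    · exact hlC.holds_ballE hl (by simp [Expr.eval]) (sub l)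
    · exact hlC.holds_memE hl (by simp [Expr.eval]) (hux l)
  · refine hlD.holds_allE (Q := fun T => T ⊆ insert x (LD[i] ∪ LD[j]) → x ∉ T) fun l hl =>
      holds_imp.trans (imp_congr ?_ ?_)
    · exact hlD.holds_ballE hl (by simp [Expr.eval]) (sub l)
    · rw [holds_not, hlD.holds_memE hl (by simp [Expr.eval]) (hux l)]

theorem expresses_ruleE (hC : ∀ S, S ∈ LC ↔ S ∈ C) (hD : ∀ S, S ∈ LD ↔ S ∈ D) :
    Expresses k b LC LD (ruleE k) (ruleGraph C D) := by
  intro m h ρ x y hx hy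
  rw [ruleE, holds_and, holds_or, holds_or, holds_or, holds_not, holds_eq,
    h.holds_pathRuleE hC (by lia) (by lia) hx hy, h.holds_pathRuleE hC (by lia) (by lia) hy hx,
    h.holds_starRuleE hC hD (by lia) (by lia) hx hy,
    h.holds_starRuleE hC hD (by lia) (by lia) hy hx, ruleGraph, SimpleGraph.fromRel_adj,
    Expr.eval, Expr.eval, hx, hy, ne_eq, Fin.ext_iff]

end

/-! ### Candidates for small graphs -/

open Classical in
/-- Adjacency in a fixed graph. -/
noncomputable def constE {N : ℕ} (G : SimpleGraph (Fin N)) : Expr :=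
  anyOf fun p : Fin N × Fin N => if G.Adj p.1 p.2 then
    and (eq (.var 0) (.const p.1)) (eq (.var 1) (.const p.2)) else .const 0

theorem expresses_constE (G : SimpleGraph (Fin n)) : Expresses k b LC LD (constE G) G := by
  intro m _ ρ x y hx hy
  rw [constE, holds_anyOf]
  constructor
  · rintro ⟨p, hp⟩
    split at hp
    · next hadj =>
      rw [holds_and, holds_eq, holds_eq] at hp
      simp only [Expr.eval, hx, hy] at hp
      rwa [Fin.ext hp.1, Fin.ext hp.2]
    · simp [holds_const] at hp
  · intro hxy
    refine ⟨(x, y), ?_⟩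
    rw [if_pos hxy, holds_and, holds_eq, holds_eq]
    exact ⟨hx, hy⟩

namespace Stmt

/-- One statement for every member of a list. -/
def forEach {ι : Type*} (l : List ι) (f : ι → Stmt) : Stmt :=
  l.foldr (fun i P => .seq (f i) P) .skip

theorem eval_forEach {ι : Type*} {l : List ι} {f : ι → Stmt} (R : State → Prop) (g : ι → List ℕ)
    (hs : ∀ i ∈ l, ∀ τ, R τ → R ((f i).eval b τ) ∧ ((f i).eval b τ).out = τ.out ++ g i)
    {σ : State} (h0 : R σ) :
    R ((forEach l f).eval b σ) ∧ ((forEach l f).eval b σ).out = σ.out ++ l.flatMap g := by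
  induction l generalizing σ with
  | nil => exact ⟨h0, by simp [forEach, eval]⟩
  | cons i l ih =>
    obtain ⟨h1, h2⟩ := hs i (by simp) σ h0
    obtain ⟨h3, h4⟩ := ih (fun j hj => hs j (by simp [hj])) h1
    refine ⟨h3, h4.trans ?_⟩
    rw [h2, List.flatMap_cons, List.append_assoc]

end Stmt

/-- Check all graphs on `N` vertices. -/
noncomputable def tryAll (k N : ℕ) : Stmt :=
  .forEach (Finset.univ : Finset (SimpleGraph (Fin N))).toList fun G => checkAndEmit k (constE G)

/-- Check all graphs if there are fewer than `N` vertices, and otherwise the one graph that the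
rules describe. -/
noncomputable def enumerate (k N : ℕ) : Stmt :=
  .ite (lt numE (.const N))
    (.forEach (List.range N) fun N' => .ite (eq numE (.const N')) (tryAll k N') .skip)
    (checkAndEmit k (ruleE k))

section

variable {C D : Finset (Finset (Fin n))} [DecidablePred (IsSolution k C D)]

theorem eval_tryAll (hk : 0 < k) (hCD : IsCompleteKSets k C D)
    (hC : ∀ S, S ∈ LC ↔ S ∈ C) (hD : ∀ S, S ∈ LD ↔ S ∈ D) {σ : State}
    (hσ : IsInput k b LC LD σ.mem) :
    IsInput k b LC LD ((tryAll k n).eval b σ).mem ∧ ((tryAll k n).eval b σ).out = σ.out ++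
      (Finset.univ : Finset (SimpleGraph (Fin n))).toList.flatMap
        fun G => if IsSolution k C D G then encodeGraph G else [] :=
  Stmt.eval_forEach (fun τ => IsInput k b LC LD τ.mem) _
    (fun G _ _ hτ => (expresses_constE G).eval_checkAndEmit hk hCD hC hD hτ) hσ

theorem eval_enumerate_of_lt (hk : 0 < k) {N : ℕ} (hn : n < N) (hCD : IsCompleteKSets k C D)
    (hC : ∀ S, S ∈ LC ↔ S ∈ C) (hD : ∀ S, S ∈ LD ↔ S ∈ D) {σ : State}
    (hσ : IsInput k b LC LD σ.mem) :
    ((enumerate k N).eval b σ).out = σ.out ++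
      (Finset.univ : Finset (SimpleGraph (Fin n))).toList.flatMap
        fun G => if IsSolution k C D G then encodeGraph G else [] := by
  have hcond : σ.val b (lt numE (.const N)) ≠ 0 := by
    refine holds_lt.2 ?_
    rw [hσ.eval_numE]
    exact hn
  generalize hl : ((Finset.univ : Finset (SimpleGraph (Fin n))).toList.flatMap
    fun G => if IsSolution k C D G then encodeGraph G else []) = l
  have hrange : ∀ M : ℕ, (List.range M).flatMap (fun N' => if N' = n then l else []) =
      if n < M then l else [] := by
    intro M
    induction M with
    | zero => simp
    | succ M ih =>
      rw [List.range_succ, List.flatMap_append, ih, List.flatMap_singleton]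
      rcases lt_trichotomy n M with h | rfl | h
      · simp [h, h.ne', h.trans (Nat.lt_succ_self M)]
      · simp
      · simp [h.not_gt, h.ne, show ¬ n < M + 1 by lia]
  have hloop := Stmt.eval_forEach (b := b) (l := List.range N)
    (f := fun N' => .ite (eq numE (.const N')) (tryAll k N') .skip)
    (fun τ => IsInput k b LC LD τ.mem) (fun N' => if N' = n then l else []) (by
      intro N' _ τ hτ
      have hc : τ.val b (eq numE (.const N')) ≠ 0 ↔ N' = n := by
        refine holds_eq.trans ?_
        rw [hτ.eval_numE, Expr.eval, eq_comm]
      rw [Stmt.eval]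
      by_cases h : N' = n
      · rw [if_pos (hc.2 h), if_pos h, h, ← hl]
        exact eval_tryAll hk hCD hC hD hτ
      · rw [if_neg fun h' => h (hc.1 h'), if_neg h, List.append_nil]
        exact ⟨hτ, rfl⟩) hσ
  rw [enumerate, Stmt.eval, if_pos hcond, hloop.2, hrange, if_pos hn]

theorem eval_enumerate_of_le (hk : 0 < k) {N : ℕ} (hn : N ≤ n) (hCD : IsCompleteKSets k C D)
    (hC : ∀ S, S ∈ LC ↔ S ∈ C) (hD : ∀ S, S ∈ LD ↔ S ∈ D) {σ : State}
    (hσ : IsInput k b LC LD σ.mem) :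
    ((enumerate k N).eval b σ).out = σ.out ++
      if IsSolution k C D (ruleGraph C D) then encodeGraph (ruleGraph C D) else [] := by
  have hcond : ¬ σ.val b (lt numE (.const N)) ≠ 0 := by
    refine fun h => (holds_lt.1 h).not_ge ?_
    rw [hσ.eval_numE]
    exact hn
  rw [enumerate, Stmt.eval, if_neg hcond]
  exact ((expresses_ruleE hC hD).eval_checkAndEmit hk hCD hC hD hσ).2

end

theorem eval_enumerate (hk : 2 ≤ k) {C D : Finset (Finset (Fin n))} (hCD : IsCompleteKSets k C D)
    (hC : ∀ S, S ∈ LC ↔ S ∈ C) (hD : ∀ S, S ∈ LD ↔ S ∈ D) {σ : State}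
    (hσ : IsInput k b LC LD σ.mem) :
    ∃ L : List (SimpleGraph (Fin n)),
      ((enumerate k (4 * k ^ 2 + 3)).eval b σ).out = σ.out ++ L.flatMap encodeGraph ∧
      Enumerates L (IsSolution k C D) := by
  classical
  by_cases hn : n < 4 * k ^ 2 + 3
  · refine ⟨(Finset.univ : Finset (SimpleGraph (Fin n))).toList.filter fun G => IsSolution k C D G,
      ?_, (Finset.nodup_toList _).filter _, fun G => by simp⟩
    rw [← List.flatMap_ite_eq_flatMap_filter]
    exact eval_enumerate_of_lt (by lia) hn hCD hC hD hσ
  · refine ⟨[ruleGraph C D].filter fun G => IsSolution k C D G, ?_,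
      (List.nodup_singleton _).filter _, fun G => ?_⟩
    · rw [← List.flatMap_ite_eq_flatMap_filter, List.flatMap_singleton]
      exact eval_enumerate_of_le (by lia) (by lia) hCD hC hD hσ
    · simp only [List.mem_filter, List.mem_singleton, decide_eq_true_eq]
      refine ⟨fun h => h.2, fun h => ⟨?_, h⟩⟩
      exact h.2.2.eq_ruleGraph hk hCD h.2.1 h.1 (by rw [Fintype.card_fin]; lia)

/-! ### The machine program -/

/-- The bound that the main program works with. -/
def boundE (k : ℕ) : Expr :=
  .add (.add numE listC.length) (.add (listD k).length (.const k))

/-- Put `1` in register `1` and the bound in register `0`, then run the compiled statement.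
The bound is computed while register `0` still holds `0`, which is harmless as
`boundE` contains no sum. -/
noncomputable def enumerateProg (k N : ℕ) : Prog :=
  .seq (.const 1 1) (.seq ((boundE k).compile ((boundE k).numVars + 3)) (.seq
    (.add 0 ((boundE k).numVars + 3) 2)
    ((enumerate k N).compile ((enumerate k N).numVars + 3))))

end RAM

open RAM in
theorem mainTheorem2 (k : ℕ) (hk : 2 ≤ k) :
    ∃ (P : RAM.Prog) (p : Polynomial ℕ),
      ∀ (n : ℕ) (C D : Finset (Finset (Fin n))), IsCompleteKSets k C D →
        ∀ LC LD : List (Finset (Fin n)),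
          LC.Nodup → (∀ S, S ∈ LC ↔ S ∈ C) → LD.Nodup → (∀ S, S ∈ LD ↔ S ∈ D) →
            ∃ (t : ℕ) (s : RAM.Cfg) (L : List (SimpleGraph (Fin n))),
              RAM.Runs P (RAM.init (encodeInput LC LD)) t s ∧
              t ≤ p.eval n ∧
              s.out = L.flatMap encodeGraph ∧
              Enumerates L (fun G => G.Connected ∧ G.CliqueFree 3 ∧ IsConsistent k C D G) := by
  classical
  set S := enumerate k (4 * k ^ 2 + 3) with hS
  refine ⟨enumerateProg k (4 * k ^ 2 + 3),
    .C ((boundE k).cost.eval 0 + 2) + S.cost.comp (.X + .X ^ k + .C k),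
    fun n C D hCD LC LD hLC hC hLD hD => ?_⟩
  set b := n + LC.length + (LD.length + k) with hb
  have hin : IsInput k b LC LD (init (encodeInput LC LD)).mem :=
    { le_bound := by lia
      length_left_le := by lia
      length_right_le := by lia
      card_left := fun T hT => (hCD.mem_iff T).1 (Or.inl ((hC T).1 hT))
      card_right := fun T hT => (hCD.mem_iff T).1 (Or.inr ((hD T).1 hT))
      mem_eq := fun _ _ => rfl }
  have hbound : b ≤ n + n ^ k + k := by
    have h1 : LC.length = C.card := by
      rw [← List.toFinset_card_of_nodup hLC]
      congr 1
      ext S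
      simp [hC]
    have h2 : LD.length = D.card := by
      rw [← List.toFinset_card_of_nodup hLD]
      congr 1
      ext S
      simp [hD]
    have h3 : C ∪ D = Finset.powersetCard k Finset.univ := by
      ext S
      simp [hCD.mem_iff]
    have h4 : C.card + D.card = n.choose k := by
      rw [← Finset.card_union_of_disjoint hCD.disjoint, h3, Finset.card_powersetCard,
        Finset.card_univ, Fintype.card_fin]
    have := Nat.choose_le_pow n k
    lia
  set w := (boundE k).numVars + 3 with hw
  obtain ⟨t₁, s₁, r₁, ht₁, hm₁, ho₁, hp₁, hv₁⟩ := (boundE k).runs_compile w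
    ((init (encodeInput LC LD)).setReg 1 1) le_rfl (by simp) (by simp [init])
  have hw₁ : s₁.reg w = b := by
    rw [hv₁]
    simp only [Cfg.setReg_mem, boundE, numE, listC, listD, Expr.eval, Expr.eval_mulConst,
      hin.mem_zero, hin.mem_one, hin.mem_length_right]
    rfl
  set s₂ := s₁.setReg 0 (s₁.reg w + s₁.reg 2) with hs₂
  have hrep : Stmt.Represents b (S.numVars + 3)
      ⟨fun i => s₂.reg (i + 3), (init (encodeInput LC LD)).mem, []⟩ s₂ :=
    { bound := by simp [hs₂, hw₁, hp₁ 2 (by lia), init]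
      one := by simp [hs₂, hp₁ 1 (by lia)]
      zero := by simp [hs₂, hp₁ 2 (by lia), init]
      var := fun _ _ => rfl
      mem := hm₁
      out := ho₁ }
  obtain ⟨t₃, s₃, r₃, ht₃, h₃, -⟩ := S.runs_compile b _ _ _ _ le_rfl le_rfl hrep
  obtain ⟨L, hL, hLp⟩ := eval_enumerate (b := b) hk hCD hC hD (σ := ⟨fun i => s₂.reg (i + 3),
    (init (encodeInput LC LD)).mem, []⟩) hin
  refine ⟨_, s₃, L, .seq (.const ..) (.seq r₁ (.seq (.add ..) r₃)), ?_, ?_, hLp⟩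
  · have hmono : S.cost.eval b ≤ S.cost.eval (n + n ^ k + k) := by
      rw [Polynomial.eval_eq_sum_range, Polynomial.eval_eq_sum_range]
      gcongr
    simp only [Polynomial.eval_add, Polynomial.eval_comp, Polynomial.eval_C, Polynomial.eval_X,
      Polynomial.eval_pow]
    have h0 : ((init (encodeInput LC LD)).setReg 1 1).reg 0 = 0 := by simp [init]
    rw [h0] at ht₁
    lia
  · rw [h₃.out, hL, List.nil_append]
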